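/- Let $k$ be a field of arbitrary characteristic, $\mathfrak g$ a Lie algebra over $k$ (of any dimension), $\mathfrak h\subseteq\mathfrak g$ a Lie subalgebra, and $\mathfrak n=\mathfrak g/\mathfrak h$ the quotient $\mathfrak h$-module. For an $\mathfrak h$-module $E$, let $\alpha_E\in\mathrm{Ext}^1_{\mathfrak h}(\mathfrak n\otimes E,E)$ be the class of the extension $0\to\mathfrak h\otimes E\to\mathfrak g\otimes E\to\mathfrak n\otimes E\to0$ composed with the action map $\mathfrak h\otimes E\to E$, and put $\alpha=\alpha_{\mathfrak n}$. Let $L(\mathfrak g)$ be the free Lie algebra on the vector space $\mathfrak g$ and let $\mathfrak h^{(1)}$ be the quotient of $L(\mathfrak g)$ by the Lie ideal generated by all $[x,y]-[x,y]_{\mathfrak g}$ with $x\in\mathfrak h$, $y\in\mathfrak g$. Let $j:\mathfrak h\to\mathfrak h^{(1)}$ be the natural map of Lie algebras. Let $\mathfrak h$ act through $j$, by left multiplication, on $M=U(\mathfrak h^{(1)})/U(\mathfrak h^{(1)})\mathfrak h$, a quotient of the tensor algebra $T(\mathfrak g)$, and let $F^m\subseteq M$ be the $\mathfrak h$-submodule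 of those elements that have a lift to $T(\mathfrak g)$ of degree at most $m$. We say that $F^\bullet$ splits if for every $m\ge1$ the exact sequence of $\mathfrak h$-modules $0\to F^{m-1}\to F^m\to F^m/F^{m-1}\to0$ splits. Then: 1. $F^\bullet$ splits if and only if $\alpha=0$. 2. $\alpha=0$ if and only if the $\mathfrak h$-module structure of $\mathfrak n$ is the restriction along $j$ of an $\mathfrak h^{(1)}$-module structure on $\mathfrak n$. 3. For every such $\mathfrak h^{(1)}$-module structure on $\mathfrak n$ there are linear maps $s_m:\mathfrak n^{\otimes m}\to M$ $(m\ge0)$ with $s_0(1)=[1]$ and $$s_{m+1}(\bar a\otimes X)=a\cdot s_m(X)-s_m(a\cdot X)\qquad(a\in\mathfrak g,\ X\in\mathfrak n^{\otimes m}),$$ where $\bar a$ is the class of $a$ in $\mathfrak n$ and $a$ acts on $M$ and, by the Leibniz rule, on $\mathfrak n^{\otimes m}$ through its image in $\mathfrak h^{(1)}$. They split the filtration: for every $m\ge1$ there is an $\mathfrak h$-linear section $\sigma$ of $F^m\to F^m/F^{m-1}$ such that $\sigma([a_1\cdots a_m])=s_m(\bar a_1\otimes\cdots\otimes\bar a_m)$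 for all $a_1,\dots,a_m\in\mathfrak g$. -/

import Mathlib

open CategoryTheory CategoryTheory.Abelian
open scoped TensorProduct

attribute [local instance 100] LieRing.ofAssociativeRing

noncomputable section

namespace LiePBW

universe u v w

/-! ### Representations as modules over the enveloping algebra -/

section Representations

variable (k : Type u) (L : Type v) [Field k] [LieRing L] [LieAlgebra k L]

/-- The `U(L)`-module structure on an `L`-module `M`. -/
abbrev envelopingModule (M : Type w) [AddCommGroup M] [Module k M] [LieRingModule L M]
    [LieModule k L M] : Module (UniversalEnvelopingAlgebra k L) M :=
  Module.compHom M
    (UniversalEnvelopingAlgebra.lift k (LieModule.toEnd k L M)).toRingHom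

theorem enveloping_induction (P : UniversalEnvelopingAlgebra k L → Prop)
    (hs : ∀ c : k, P (algebraMap k _ c))
    (hι : ∀ x : L, P (UniversalEnvelopingAlgebra.ι k x))
    (hm : ∀ a b, P a → P b → P (a * b)) (ha : ∀ a b, P a → P b → P (a + b))
    (a : UniversalEnvelopingAlgebra k L) : P a := by
  obtain ⟨t, rfl⟩ : ∃ t, UniversalEnvelopingAlgebra.mkAlgHom k L t = a := by
    obtain ⟨t, ht⟩ := Quotient.exists_rep a
    exact ⟨t, ht⟩
  induction t using TensorAlgebra.induction with
  | algebraMap r => simpa using hs r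
  | ι x => exact hι x
  | mul a b h1 h2 => simpa using hm _ _ h1 h2
  | add a b h1 h2 => simpa using ha _ _ h1 h2

/-- An `L`-module, as an object of the abelian category of `U(L)`-modules. -/
def repObj (M : Type w) [AddCommGroup M] [Module k M] [LieRingModule L M]
    [LieModule k L M] : ModuleCat.{w} (UniversalEnvelopingAlgebra k L) :=
  letI := envelopingModule k L M
  ModuleCat.of (UniversalEnvelopingAlgebra k L) M

/-- A morphism of `L`-modules, as a morphism of `U(L)`-modules. -/
def repHom {M N : Type w} [AddCommGroup M] [Module k M] [LieRingModule L M]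
    [LieModule k L M] [AddCommGroup N] [Module k N] [LieRingModule L N]
    [LieModule k L N] (f : M →ₗ⁅k,L⁆ N) : repObj k L M ⟶ repObj k L N :=
  letI := envelopingModule k L M
  letI := envelopingModule k L N
  ModuleCat.ofHom
    { toFun := f
      map_add' := map_add f
      map_smul' := by
        intro a
        induction a using enveloping_induction with
        | hs c =>
          intro m
          change f (UniversalEnvelopingAlgebra.lift k (LieModule.toEnd k L M) _ m) =
            UniversalEnvelopingAlgebra.lift k (LieModule.toEnd k L N) _ (f m)
          simp
        | hι x =>
          intro m
          change f (UniversalEnvelopingAlgebra.lift k (LieModule.toEnd k L M) _ m) =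
            UniversalEnvelopingAlgebra.lift k (LieModule.toEnd k L N) _ (f m)
          simp
        | hm a b ha hb =>
          intro m
          simp only [RingHom.id_apply] at ha hb ⊢
          rw [mul_smul, ha, hb, mul_smul]
        | ha a b ha hb =>
          intro m
          simp only [RingHom.id_apply] at ha hb ⊢
          rw [add_smul, map_add, ha, hb, add_smul] }

end Representations

section Pair

variable {k : Type u} {g : Type v} [Field k] [LieRing g] [LieAlgebra k g]
variable (h : LieSubalgebra k g)

/-! ### The quotient module `n = g / h` and the class `α` -/

/-- The `h`-module `n = g / h`. -/
abbrev normalModule : Type v := g ⧸ h.toLieSubmodule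

/-- The projection `g → n`, a morphism of `h`-modules. -/
abbrev normalProj : g →ₗ⁅k,h⁆ normalModule h := LieSubmodule.Quotient.mk' h.toLieSubmodule

section Alpha

variable (E : Type v) [AddCommGroup E] [Module k E] [LieRingModule h E] [LieModule k h E]

/-- The complex `h ⊗ E → g ⊗ E → n ⊗ E` of `h`-modules. -/
def tensorSequence : ShortComplex (ModuleCat.{v} (UniversalEnvelopingAlgebra k h)) where
  X₁ := repObj k h (h ⊗[k] E)
  X₂ := repObj k h (g ⊗[k] E)
  X₃ := repObj k h (normalModule h ⊗[k] E)
  f := repHom k h (TensorProduct.LieModule.map h.incl' LieModuleHom.id)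
  g := repHom k h (TensorProduct.LieModule.map (normalProj h) LieModuleHom.id)
  zero := by
    ext t
    change TensorProduct.LieModule.map (normalProj h) LieModuleHom.id
      (TensorProduct.LieModule.map h.incl' LieModuleHom.id t) = 0
    induction t using TensorProduct.induction_on with
    | zero => simp
    | tmul x e =>
      have : normalProj h (h.incl' x) = 0 :=
        (LieSubmodule.Quotient.mk_eq_zero _).2 x.2
      rw [TensorProduct.LieModule.map_tmul, TensorProduct.LieModule.map_tmul, this,
        TensorProduct.zero_tmul]
    | add a b ha hb => rw [map_add, map_add, ha, hb, add_zero]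

theorem tensorSequence_shortExact : (tensorSequence h E).ShortExact := by
  refine ModuleCat.shortComplex_shortExact _ ?_ ?_ ?_
  · have hex : Function.Exact (h.incl' : h →ₗ[k] g) (normalProj h : g →ₗ[k] normalModule h) := by
      intro y
      refine (LieSubmodule.Quotient.mk_eq_zero _).trans ⟨fun hy => ⟨⟨y, hy⟩, rfl⟩, ?_⟩
      rintro ⟨x, rfl⟩
      exact x.2
    exact rTensor_exact E hex (LieSubmodule.Quotient.surjective_mk' _)
  · exact Module.Flat.rTensor_preserves_injective_linearMap (M := E) (h.incl' : h →ₗ[k] g)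
      Subtype.val_injective
  · exact LinearMap.rTensor_surjective E (LieSubmodule.Quotient.surjective_mk' h.toLieSubmodule)

/-- The class `α_E ∈ Ext¹_h(n ⊗ E, E)`: the extension class of `h ⊗ E → g ⊗ E → n ⊗ E`
followed by the action map `h ⊗ E → E`. -/
def alphaClass :
    letI := HasExt.standard (ModuleCat.{v} (UniversalEnvelopingAlgebra k h))
    Ext (repObj k h (normalModule h ⊗[k] E)) (repObj k h E) 1 :=
  letI := HasExt.standard (ModuleCat.{v} (UniversalEnvelopingAlgebra k h))
  (tensorSequence_shortExact h E).extClass.comp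
    (Ext.mk₀ (repHom k h (LieModule.toModuleHom k h E))) (add_zero 1)

end Alpha

/-- The class `α = α_n ∈ Ext¹_h(n ⊗ n, n)`. -/
abbrev alpha :
    letI := HasExt.standard (ModuleCat.{v} (UniversalEnvelopingAlgebra k h))
    Ext (repObj k h (normalModule h ⊗[k] normalModule h)) (repObj k h (normalModule h)) 1 :=
  alphaClass h (normalModule h)

/-! ### The first order neighborhood Lie algebra -/

section FreeLie

variable (k) (V : Type v) [AddCommGroup V] [Module k V]

/-- The Lie ideal of the free Lie algebra on the set `V` that imposes the linearity of `V`. -/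
def linearityIdeal : LieIdeal k (FreeLieAlgebra k V) :=
  LieSubmodule.lieSpan k (FreeLieAlgebra k V)
    ({z | ∃ x y : V, z = FreeLieAlgebra.of k (x + y) -
        (FreeLieAlgebra.of k x + FreeLieAlgebra.of k y)} ∪
      {z | ∃ (c : k) (x : V), z = FreeLieAlgebra.of k (c • x) - c • FreeLieAlgebra.of k x})

/-- The free Lie algebra `L(V)` generated by the vector space `V`. -/
abbrev FreeLie : Type (max u v) := FreeLieAlgebra k V ⧸ linearityIdeal k V

/-- The linear map `V → L(V)`. -/
def FreeLie.ι : V →ₗ[k] FreeLie k V where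
  toFun x := LieSubmodule.Quotient.mk (FreeLieAlgebra.of k x)
  map_add' x y := by
    have hmem := LieSubmodule.subset_lieSpan (R := k) (L := FreeLieAlgebra k V)
      (Set.mem_union_left {z | ∃ (c : k) (x : V), z = FreeLieAlgebra.of k (c • x) -
          c • FreeLieAlgebra.of k x}
        (show _ ∈ {z | ∃ x y : V, z = FreeLieAlgebra.of k (x + y) -
          (FreeLieAlgebra.of k x + FreeLieAlgebra.of k y)} from ⟨x, y, rfl⟩))
    exact (Submodule.Quotient.eq (linearityIdeal k V).toSubmodule).2 hmem
  map_smul' c x := by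
    have hmem := LieSubmodule.subset_lieSpan (R := k) (L := FreeLieAlgebra k V)
      (Set.mem_union_right {z | ∃ x y : V, z = FreeLieAlgebra.of k (x + y) -
          (FreeLieAlgebra.of k x + FreeLieAlgebra.of k y)}
        (show _ ∈ {z | ∃ (c : k) (x : V), z = FreeLieAlgebra.of k (c • x) -
          c • FreeLieAlgebra.of k x} from ⟨c, x, rfl⟩))
    exact (Submodule.Quotient.eq (linearityIdeal k V).toSubmodule).2 hmem

end FreeLie

/-- The Lie ideal of `L(g)` generated by `[x, y] - [x, y]_g` for `x ∈ h` and `y ∈ g`. -/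
def nbhdIdeal : LieIdeal k (FreeLie k g) :=
  LieSubmodule.lieSpan k (FreeLie k g)
    {z | ∃ (x : h) (y : g),
      z = ⁅FreeLie.ι k g (x : g), FreeLie.ι k g y⁆ - FreeLie.ι k g ⁅(x : g), y⁆}

/-- The first order neighborhood Lie algebra `h⁽¹⁾`. -/
abbrev Nbhd : Type (max u v) := FreeLie k g ⧸ nbhdIdeal h

/-- The linear map `g → h⁽¹⁾`. -/
def nbhdGen : g →ₗ[k] Nbhd h :=
  (LieSubmodule.Quotient.mk' (nbhdIdeal h) : FreeLie k g →ₗ[k] Nbhd h) ∘ₗ FreeLie.ι k g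

theorem nbhdGen_lie (x : h) (y : g) :
    nbhdGen h ⁅(x : g), y⁆ = ⁅nbhdGen h (x : g), nbhdGen h y⁆ := by
  have hmem := LieSubmodule.subset_lieSpan (R := k) (L := FreeLie k g)
    (show _ ∈ {z | ∃ (x : h) (y : g),
      z = ⁅FreeLie.ι k g (x : g), FreeLie.ι k g y⁆ - FreeLie.ι k g ⁅(x : g), y⁆} from ⟨x, y, rfl⟩)
  exact ((Submodule.Quotient.eq (nbhdIdeal h).toSubmodule).2 hmem).symm

/-- The natural map of Lie algebras `j : h → h⁽¹⁾`. -/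
def nbhdIncl : h →ₗ⁅k⁆ Nbhd h :=
  { nbhdGen h ∘ₗ (h.incl' : h →ₗ[k] g) with
    map_lie' := fun {x y} => nbhdGen_lie h x y }

/-! ### The `h`-module `U(h⁽¹⁾) / U(h⁽¹⁾) h` and its filtration -/

/-- The left ideal `U(h⁽¹⁾) h` of `U(h⁽¹⁾)`. -/
def leftIdeal : Submodule (UniversalEnvelopingAlgebra k (Nbhd h))
    (UniversalEnvelopingAlgebra k (Nbhd h)) :=
  Submodule.span _ (Set.range fun x : h => UniversalEnvelopingAlgebra.ι k (nbhdIncl h x))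

/-- The left `U(h⁽¹⁾)`-module `U(h⁽¹⁾) / U(h⁽¹⁾) h`. -/
def Ind : Type (max u v) := UniversalEnvelopingAlgebra k (Nbhd h) ⧸ leftIdeal h

instance : AddCommGroup (Ind h) :=
  inferInstanceAs (AddCommGroup (UniversalEnvelopingAlgebra k (Nbhd h) ⧸ leftIdeal h))

instance : Module (UniversalEnvelopingAlgebra k (Nbhd h)) (Ind h) :=
  inferInstanceAs (Module _ (UniversalEnvelopingAlgebra k (Nbhd h) ⧸ leftIdeal h))

instance : Module k (Ind h) :=
  inferInstanceAs (Module k (UniversalEnvelopingAlgebra k (Nbhd h) ⧸ leftIdeal h))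

instance : IsScalarTower k (UniversalEnvelopingAlgebra k (Nbhd h)) (Ind h) :=
  inferInstanceAs (IsScalarTower k (UniversalEnvelopingAlgebra k (Nbhd h))
    (UniversalEnvelopingAlgebra k (Nbhd h) ⧸ leftIdeal h))

/-- The projection `U(h⁽¹⁾) → U(h⁽¹⁾) / U(h⁽¹⁾) h`. -/
def Ind.mk : UniversalEnvelopingAlgebra k (Nbhd h) →ₗ[UniversalEnvelopingAlgebra k (Nbhd h)] Ind h :=
  (leftIdeal h).mkQ

/-- `h` acts on `U(h⁽¹⁾) / U(h⁽¹⁾) h` by left multiplication, through `j`. -/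
instance : LieRingModule h (Ind h) where
  bracket x m := UniversalEnvelopingAlgebra.ι k (nbhdIncl h x) • m
  add_lie x y m := by
    change UniversalEnvelopingAlgebra.ι k (nbhdIncl h (x + y)) • m = _ • m + _ • m
    rw [map_add, map_add, add_smul]
  lie_add x m n := smul_add _ m n
  leibniz_lie x y m := by
    change UniversalEnvelopingAlgebra.ι k (nbhdIncl h x) •
        UniversalEnvelopingAlgebra.ι k (nbhdIncl h y) • m =
      UniversalEnvelopingAlgebra.ι k (nbhdIncl h ⁅x, y⁆) • m +
        UniversalEnvelopingAlgebra.ι k (nbhdIncl h y) •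
          UniversalEnvelopingAlgebra.ι k (nbhdIncl h x) • m
    rw [LieHom.map_lie, LieHom.map_lie, LieRing.of_associative_ring_bracket, sub_smul, mul_smul,
      mul_smul, sub_add_cancel]

theorem Ind.lie_def (x : h) (m : Ind h) :
    ⁅x, m⁆ = UniversalEnvelopingAlgebra.ι k (nbhdIncl h x) • m := rfl

instance : LieModule k h (Ind h) where
  smul_lie c x m := by
    rw [Ind.lie_def, Ind.lie_def, map_smul, map_smul, smul_assoc]
  lie_smul c x m := by
    rw [Ind.lie_def, Ind.lie_def, ← algebraMap_smul (UniversalEnvelopingAlgebra k (Nbhd h)) c m,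
      ← mul_smul, ← Algebra.commutes, mul_smul, algebraMap_smul]

/-- The natural algebra map `T(g) → U(h⁽¹⁾)`. -/
def tensorToU : TensorAlgebra k g →ₐ[k] UniversalEnvelopingAlgebra k (Nbhd h) :=
  TensorAlgebra.lift k
    ((UniversalEnvelopingAlgebra.ι k : Nbhd h →ₗ⁅k⁆ _).toLinearMap ∘ₗ nbhdGen h)

/-- The natural linear map `T(g) → U(h⁽¹⁾) / U(h⁽¹⁾) h`. -/
def tensorToInd : TensorAlgebra k g →ₗ[k] Ind h :=
  ((Ind.mk h).restrictScalars k) ∘ₗ (tensorToU h).toLinearMap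

variable (k g) in
/-- The tensors of degree at most `m` in `T(g)`. -/
def tensorsLE (m : ℕ) : Submodule k (TensorAlgebra k g) :=
  ⨆ i : Fin (m + 1), LinearMap.range (TensorAlgebra.ι k : g →ₗ[k] TensorAlgebra k g) ^ (i : ℕ)

theorem tensorToU_commutator (x : h) (i : ℕ) (t : TensorAlgebra k g)
    (ht : t ∈ LinearMap.range (TensorAlgebra.ι k : g →ₗ[k] TensorAlgebra k g) ^ i) :
    ∃ t' ∈ LinearMap.range (TensorAlgebra.ι k : g →ₗ[k] TensorAlgebra k g) ^ i,
      UniversalEnvelopingAlgebra.ι k (nbhdIncl h x) * tensorToU h t =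
        tensorToU h t' + tensorToU h t * UniversalEnvelopingAlgebra.ι k (nbhdIncl h x) := by
  induction ht using Submodule.pow_induction_on_left' with
  | algebraMap r =>
    exact ⟨0, Submodule.zero_mem _, by
      rw [AlgHom.commutes, map_zero, zero_add, Algebra.commutes]⟩
  | add a b i ha hb iha ihb =>
    obtain ⟨a', ha', ea⟩ := iha
    obtain ⟨b', hb', eb⟩ := ihb
    refine ⟨a' + b', Submodule.add_mem _ ha' hb', ?_⟩
    rw [map_add, map_add, mul_add, ea, eb, add_mul]
    abel
  | mem_mul m hm i t ht iht =>
    obtain ⟨y, rfl⟩ := hm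
    obtain ⟨t', ht', et⟩ := iht
    refine ⟨TensorAlgebra.ι k ⁅(x : g), y⁆ * t + TensorAlgebra.ι k y * t', ?_, ?_⟩
    · rw [pow_succ']
      exact Submodule.add_mem _ (Submodule.mul_mem_mul ⟨_, rfl⟩ ht)
        (Submodule.mul_mem_mul ⟨_, rfl⟩ ht')
    · have hg : ∀ z : g, tensorToU h (TensorAlgebra.ι k z) =
          UniversalEnvelopingAlgebra.ι k (nbhdGen h z) := fun z => by
        simp [tensorToU]
      have hx : nbhdIncl h x = nbhdGen h (x : g) := rfl
      rw [map_add, map_mul, map_mul, map_mul, hg, hg, nbhdGen_lie, LieHom.map_lie,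
        LieRing.of_associative_ring_bracket, ← hx, mul_assoc _ (tensorToU h t),
        ← sub_eq_iff_eq_add'.2 et]
      noncomm_ring

/-- The filtration `F⁰ ⊆ F¹ ⊆ …` of the `h`-module `U(h⁽¹⁾) / U(h⁽¹⁾) h`: `Fᵐ` consists of the
elements that have a lift to `T(g)` of degree at most `m`. -/
def filtration (m : ℕ) : LieSubmodule k h (Ind h) :=
  { (tensorsLE k g m).map (tensorToInd h) with
    lie_mem := by
      rintro x _ ⟨t, ht, rfl⟩
      change ⁅x, tensorToInd h t⁆ ∈ (tensorsLE k g m).map (tensorToInd h)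
      refine Submodule.iSup_induction _
        (motive := fun t => ⁅x, tensorToInd h t⁆ ∈ (tensorsLE k g m).map (tensorToInd h))
        ht ?_ ?_ ?_
      · intro i t ht
        obtain ⟨t', ht', e⟩ := tensorToU_commutator h x i t ht
        refine ⟨t', Submodule.mem_iSup_of_mem i ht', ?_⟩
        change Ind.mk h (tensorToU h t') =
          UniversalEnvelopingAlgebra.ι k (nbhdIncl h x) • Ind.mk h (tensorToU h t)
        rw [← map_smul, smul_eq_mul, e, map_add]
        have : Ind.mk h (tensorToU h t * UniversalEnvelopingAlgebra.ι k (nbhdIncl h x)) = 0 :=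
          (Submodule.Quotient.mk_eq_zero _).2
            (Submodule.smul_mem _ _ (Submodule.subset_span ⟨x, rfl⟩))
        rw [this, add_zero]
      · rw [map_zero, lie_zero]
        exact Submodule.zero_mem _
      · intro a b ha hb
        rw [map_add, lie_add]
        exact Submodule.add_mem _ ha hb }

/-- The quotient `F^{m+1} / F^m`, as an `h`-module. -/
abbrev filtrationQuotient (m : ℕ) : Type (max u v) :=
  filtration h (m + 1) ⧸ (filtration h m).comap (filtration h (m + 1)).incl

/-- `σ` is an `h`-linear section of the projection `F^{m+1} → F^{m+1} / F^m`. -/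
def IsSplitting (m : ℕ) (σ : filtrationQuotient h m →ₗ⁅k,h⁆ filtration h (m + 1)) : Prop :=
  ∀ q, LieSubmodule.Quotient.mk' ((filtration h m).comap (filtration h (m + 1)).incl) (σ q) = q

/-- The filtration splits: for every `m` the short exact sequence of `h`-modules
`0 → F^m → F^{m+1} → F^{m+1} / F^m → 0` splits (`F^{-1} = 0`). -/
def FiltrationSplits : Prop :=
  ∀ m, ∃ σ : filtrationQuotient h m →ₗ⁅k,h⁆ filtration h (m + 1), IsSplitting h m σ

end Pair

end LiePBW

end

noncomputable section

namespace LiePBW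

/-! ### Grading and derivations of the tensor algebra -/

section TensorAlgebra

variable {k V W : Type*} [CommRing k] [AddCommGroup V] [Module k V] [AddCommGroup W] [Module k W]

/-! All three claims turn on one kind of datum: a linear map ρ from g to End(n) that extends the
action of h and respects brackets with one entry in h. Those are exactly the brackets imposed in
h⁽¹⁾, so ρ amounts to an h⁽¹⁾-module structure on n extending that of h (`exists_nbhdModule_iff`).
By the long exact Ext sequence, α vanishes iff the action map h ⊗ n → n extends to an h-map g ⊗ n →
n, and currying such a map gives ρ (`alpha_eq_zero_iff`).

Given ρ, let a ∈ g act on T(n) by X ↦ ā ⊗ X + a · X, the second term being the derivation extending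
ρ(a). This satisfies the relations of h⁽¹⁾, and h kills 1, so acting on 1 gives a map from M =
U(h⁽¹⁾)/U(h⁽¹⁾)h to T(n). The leading term of the image of a₁⋯aₘ is ā₁ ⊗ ⋯ ⊗ āₘ. This triangularity
makes the map a filtered isomorphism of h-modules. Its inverse S satisfies S(ā ⊗ X) = a · S(X) − S(a
· X), and it carries the grading of T(n), which h preserves, to a splitting of the filtration
(`exists_splitting`).

Conversely, a splitting of F¹ ⊆ F² suffices. It gives an h-linear retraction F² → F¹; followed by a
projection F¹ → n killing the class of 1, it yields q : F² → n, and ρ(a)v = q(a · v) is the required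
extension. The projection must exist without any ρ at hand (`exists_ind_projection`). It comes from
an h⁽¹⁾-module built on Hom(U(h), k × n): h-maps into a coinduced module correspond to arbitrary
linear maps, so extending the action from h to g meets no obstruction there. -/

variable (k V) in
/-- The homogeneous tensors of degree `i`. -/
abbrev tensorPow (i : ℕ) : Submodule k (TensorAlgebra k V) :=
  LinearMap.range (TensorAlgebra.ι k : V →ₗ[k] TensorAlgebra k V) ^ i

variable (k V) in
/-- The tensors of degree less than `i`. -/
def tensorsLT (i : ℕ) : Submodule k (TensorAlgebra k V) :=
  ⨆ j : Fin i, tensorPow k V j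

theorem tensorPow_le_tensorsLT {i j : ℕ} (hij : i < j) : tensorPow k V i ≤ tensorsLT k V j :=
  le_iSup (fun l : Fin j => tensorPow k V l) ⟨i, hij⟩

theorem tensorsLT_mono {i j : ℕ} (hij : i ≤ j) : tensorsLT k V i ≤ tensorsLT k V j :=
  iSup_le fun l => tensorPow_le_tensorsLT (l.2.trans_le hij)

/-- Strict bounds give the inductions on degree a trivial base case. -/
theorem tensorsLT_zero : tensorsLT k V 0 = ⊥ := iSup_of_empty _

theorem tensorsLT_succ (i : ℕ) :
    tensorsLT k V (i + 1) = tensorsLT k V i ⊔ tensorPow k V i := by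
  refine le_antisymm (iSup_le fun l => ?_)
    (sup_le (tensorsLT_mono i.le_succ) (tensorPow_le_tensorsLT i.lt_succ_self))
  rcases Nat.lt_succ_iff_lt_or_eq.1 l.2 with hl | hl
  · exact (tensorPow_le_tensorsLT hl).trans le_sup_left
  · rw [hl]
    exact le_sup_right

theorem ι_mul_mem_tensorPow (v : V) {i : ℕ} {t : TensorAlgebra k V} (ht : t ∈ tensorPow k V i) :
    TensorAlgebra.ι k v * t ∈ tensorPow k V (i + 1) := by
  rw [tensorPow, pow_succ']
  exact Submodule.mul_mem_mul ⟨v, rfl⟩ ht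

theorem ι_mul_mem_tensorsLT (v : V) {i : ℕ} {t : TensorAlgebra k V} (ht : t ∈ tensorsLT k V i) :
    TensorAlgebra.ι k v * t ∈ tensorsLT k V (i + 1) := by
  have : tensorsLT k V i ≤ (tensorsLT k V (i + 1)).comap
      (LinearMap.mulLeft k (TensorAlgebra.ι k v)) :=
    iSup_le fun l t ht => tensorPow_le_tensorsLT (Nat.succ_lt_succ l.2) (ι_mul_mem_tensorPow v ht)
  exact this ht

theorem tprod_mem_tensorPow {m : ℕ} (v : Fin m → V) :
    TensorAlgebra.tprod k V m v ∈ tensorPow k V m := by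
  induction m with
  | zero => simp [TensorAlgebra.tprod_apply, tensorPow]
  | succ m ih =>
    rw [TensorAlgebra.tprod_apply, List.ofFn_succ, List.prod_cons]
    have := ih fun i => v i.succ
    rw [TensorAlgebra.tprod_apply] at this
    exact ι_mul_mem_tensorPow _ this

variable (k V) in
/-- The projection of the tensor algebra to its component of degree `i`. -/
def tensorProj (i : ℕ) : TensorAlgebra k V →ₗ[k] TensorAlgebra k V :=
  GradedAlgebra.proj (tensorPow k V) i

theorem tensorProj_mem (i : ℕ) (t : TensorAlgebra k V) : tensorProj k V i t ∈ tensorPow k V i := by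
  rw [tensorProj, GradedAlgebra.proj_apply]
  exact SetLike.coe_mem _

theorem tensorProj_of_mem {i : ℕ} {t : TensorAlgebra k V} (ht : t ∈ tensorPow k V i) :
    tensorProj k V i t = t := by
  rw [tensorProj, GradedAlgebra.proj_apply]
  exact DirectSum.decompose_of_mem_same _ ht

theorem tensorProj_of_mem_ne {i j : ℕ} {t : TensorAlgebra k V} (ht : t ∈ tensorPow k V j)
    (hij : j ≠ i) : tensorProj k V i t = 0 := by
  rw [tensorProj, GradedAlgebra.proj_apply]
  exact DirectSum.decompose_of_mem_ne _ ht hij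

theorem tensorProj_eq_zero {i : ℕ} {t : TensorAlgebra k V} (ht : t ∈ tensorsLT k V i) :
    tensorProj k V i t = 0 := by
  have : tensorsLT k V i ≤ LinearMap.ker (tensorProj k V i) :=
    iSup_le fun l t ht => tensorProj_of_mem_ne ht l.2.ne
  exact this ht

theorem sub_tensorProj_mem {i : ℕ} {t : TensorAlgebra k V} (ht : t ∈ tensorsLT k V (i + 1)) :
    t - tensorProj k V i t ∈ tensorsLT k V i := by
  rw [tensorsLT_succ] at ht
  obtain ⟨t₀, h₀, t₁, h₁, rfl⟩ := Submodule.mem_sup.1 ht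
  rw [map_add, tensorProj_eq_zero h₀, tensorProj_of_mem h₁]
  simpa using h₀

theorem exists_mem_tensorsLT (t : TensorAlgebra k V) : ∃ i, t ∈ tensorsLT k V i := by
  classical
  refine ⟨(DirectSum.decompose (tensorPow k V) t).support.sup id + 1, ?_⟩
  nth_rw 2 [← DirectSum.sum_support_decompose (tensorPow k V) t]
  refine Submodule.sum_mem _ fun j hj => ?_
  exact tensorPow_le_tensorsLT (Nat.lt_succ_of_le (Finset.le_sup (f := id) hj))
    (SetLike.coe_mem _)

/-- The algebra map of tensor algebras induced by a linear map. -/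
def tensorMap (f : V →ₗ[k] W) : TensorAlgebra k V →ₐ[k] TensorAlgebra k W :=
  TensorAlgebra.lift k (TensorAlgebra.ι k ∘ₗ f)

@[simp]
theorem tensorMap_ι (f : V →ₗ[k] W) (v : V) :
    tensorMap f (TensorAlgebra.ι k v) = TensorAlgebra.ι k (f v) := by
  simp [tensorMap]

theorem tensorMap_mem (f : V →ₗ[k] W) {i : ℕ} {t : TensorAlgebra k V}
    (ht : t ∈ tensorPow k V i) : tensorMap f t ∈ tensorPow k W i := by
  induction ht using Submodule.pow_induction_on_left' with
  | algebraMap r => simp [tensorPow]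
  | add a b i _ _ iha ihb => rw [map_add]; exact add_mem iha ihb
  | mem_mul m hm i t ht iht =>
    obtain ⟨v, rfl⟩ := hm
    rw [map_mul, tensorMap_ι]
    exact ι_mul_mem_tensorPow _ iht

theorem tensorMap_tprod (f : V →ₗ[k] W) {m : ℕ} (v : Fin m → V) :
    tensorMap f (TensorAlgebra.tprod k V m v) = TensorAlgebra.tprod k W m fun i => f (v i) := by
  simp [TensorAlgebra.tprod_apply, map_list_prod, List.map_ofFn, Function.comp_def]

/-- The algebra map `t ↦ t + ε D(t)` for the derivation `D` of the tensor algebra that extends an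
endomorphism of `V`. -/
def tensorDerivationAux (D : Module.End k V) :
    TensorAlgebra k V →ₐ[k] TrivSqZeroExt (TensorAlgebra k V) (TensorAlgebra k V) :=
  TensorAlgebra.lift k (LinearMap.inl k _ _ ∘ₗ TensorAlgebra.ι k +
    LinearMap.inr k _ _ ∘ₗ TensorAlgebra.ι k ∘ₗ D :
      V →ₗ[k] TensorAlgebra k V × TensorAlgebra k V)

theorem tensorDerivationAux_ι (D : Module.End k V) (v : V) :
    tensorDerivationAux D (TensorAlgebra.ι k v) =
      TrivSqZeroExt.inl (TensorAlgebra.ι k v) + TrivSqZeroExt.inr (TensorAlgebra.ι k (D v)) :=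
  TensorAlgebra.lift_ι_apply _ v

theorem fst_tensorDerivationAux (D : Module.End k V) (t : TensorAlgebra k V) :
    (tensorDerivationAux D t).fst = t := by
  have : (TrivSqZeroExt.fstHom k _ _).comp (tensorDerivationAux D) =
      AlgHom.id k (TensorAlgebra k V) := by
    ext v
    simp [tensorDerivationAux_ι]
  exact DFunLike.congr_fun this t

/-- The derivation of the tensor algebra that extends an endomorphism of `V`. -/
def tensorDerivation (D : Module.End k V) : Module.End k (TensorAlgebra k V) where
  toFun t := (tensorDerivationAux D t).snd
  map_add' s t := by rw [map_add, TrivSqZeroExt.snd_add]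
  map_smul' c t := by rw [map_smul, TrivSqZeroExt.snd_smul, RingHom.id_apply]

@[simp]
theorem tensorDerivation_ι (D : Module.End k V) (v : V) :
    tensorDerivation D (TensorAlgebra.ι k v) = TensorAlgebra.ι k (D v) := by
  change (tensorDerivationAux D _).snd = _
  simp [tensorDerivationAux_ι]

@[simp]
theorem tensorDerivation_algebraMap (D : Module.End k V) (c : k) :
    tensorDerivation D (algebraMap k _ c) = 0 := by
  change (tensorDerivationAux D _).snd = _
  rw [AlgHom.commutes, TrivSqZeroExt.algebraMap_eq_inl', TrivSqZeroExt.snd_inl]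

@[simp]
theorem tensorDerivation_one (D : Module.End k V) : tensorDerivation D 1 = 0 := by
  simpa using tensorDerivation_algebraMap D 1

@[simp]
theorem tensorDerivation_mul (D : Module.End k V) (s t : TensorAlgebra k V) :
    tensorDerivation D (s * t) = s * tensorDerivation D t + tensorDerivation D s * t := by
  change (tensorDerivationAux D _).snd = _
  rw [map_mul, TrivSqZeroExt.snd_mul, fst_tensorDerivationAux, fst_tensorDerivationAux]
  rfl

theorem tensorDerivation_add (D E : Module.End k V) :
    tensorDerivation (D + E) = tensorDerivation D + tensorDerivation E := by
  ext t
  induction t using TensorAlgebra.induction with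
  | algebraMap r => simp
  | ι x => simp
  | mul a b h1 h2 =>
    rw [tensorDerivation_mul, h1, h2]
    simp only [LinearMap.add_apply, tensorDerivation_mul]
    noncomm_ring
  | add a b h1 h2 => rw [map_add, map_add, h1, h2]

theorem tensorDerivation_smul (c : k) (D : Module.End k V) :
    tensorDerivation (c • D) = c • tensorDerivation D := by
  ext t
  induction t using TensorAlgebra.induction with
  | algebraMap r => simp
  | ι x => simp
  | mul a b h1 h2 =>
    rw [tensorDerivation_mul, h1, h2]
    simp only [LinearMap.smul_apply, tensorDerivation_mul, smul_add, mul_smul_comm, smul_mul_assoc]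
  | add a b h1 h2 => rw [map_add, map_add, h1, h2]

theorem tensorDerivation_lie (D E : Module.End k V) :
    tensorDerivation ⁅D, E⁆ = ⁅tensorDerivation D, tensorDerivation E⁆ := by
  simp only [LieRing.of_associative_ring_bracket]
  ext t
  induction t using TensorAlgebra.induction with
  | algebraMap r => simp
  | ι x => simp
  | mul a b h1 h2 =>
    rw [tensorDerivation_mul, h1, h2]
    simp only [LinearMap.sub_apply, Module.End.mul_apply, tensorDerivation_mul, map_add]
    noncomm_ring
  | add a b h1 h2 => rw [map_add, map_add, h1, h2]

theorem tensorDerivation_mem (D : Module.End k V) {i : ℕ} {t : TensorAlgebra k V}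
    (ht : t ∈ tensorPow k V i) : tensorDerivation D t ∈ tensorPow k V i := by
  induction ht using Submodule.pow_induction_on_left' with
  | algebraMap r => rw [tensorDerivation_algebraMap]; exact zero_mem _
  | add a b i _ _ iha ihb => rw [map_add]; exact add_mem iha ihb
  | mem_mul m hm i t ht iht =>
    obtain ⟨v, rfl⟩ := hm
    rw [tensorDerivation_mul, tensorDerivation_ι]
    exact add_mem (ι_mul_mem_tensorPow _ iht) (ι_mul_mem_tensorPow _ ht)

theorem tensorDerivation_mem_tensorsLT (D : Module.End k V) {i : ℕ} {t : TensorAlgebra k V}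
    (ht : t ∈ tensorsLT k V i) : tensorDerivation D t ∈ tensorsLT k V i := by
  have : tensorsLT k V i ≤ (tensorsLT k V i).comap (tensorDerivation D) :=
    iSup_le fun l t ht => tensorPow_le_tensorsLT l.2 (tensorDerivation_mem D ht)
  exact this ht

/-- This is what makes the splitting h-linear: on T(n), h acts by such derivations. -/
theorem tensorProj_tensorDerivation (D : Module.End k V) (i : ℕ) (t : TensorAlgebra k V) :
    tensorProj k V i (tensorDerivation D t) = tensorDerivation D (tensorProj k V i t) := by
  obtain ⟨n, hn⟩ := exists_mem_tensorsLT t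
  have : tensorsLT k V n ≤ LinearMap.eqLocus (tensorProj k V i ∘ₗ tensorDerivation D)
      (tensorDerivation D ∘ₗ tensorProj k V i) := by
    refine iSup_le fun l t ht => ?_
    rw [LinearMap.mem_eqLocus, LinearMap.comp_apply, LinearMap.comp_apply]
    by_cases hl : (l : ℕ) = i
    · rw [hl] at ht
      rw [tensorProj_of_mem ht, tensorProj_of_mem (tensorDerivation_mem D ht)]
    · rw [tensorProj_of_mem_ne ht hl, tensorProj_of_mem_ne (tensorDerivation_mem D ht) hl, map_zero]
  exact this hn

/-- Puts the derivation in the Leibniz form of the recursion for the maps sₘ. -/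
theorem tensorDerivation_tprod (D : Module.End k V) {m : ℕ} (v : Fin m → V) :
    tensorDerivation D (TensorAlgebra.tprod k V m v) =
      ∑ i, TensorAlgebra.tprod k V m (Function.update v i (D (v i))) := by
  induction m with
  | zero => simp [TensorAlgebra.tprod_apply]
  | succ m ih =>
    have hs : ∀ w : Fin (m + 1) → V, TensorAlgebra.tprod k V (m + 1) w =
        TensorAlgebra.ι k (w 0) * TensorAlgebra.tprod k V m fun i => w i.succ := fun w => by
      simp only [TensorAlgebra.tprod_apply, List.ofFn_succ, List.prod_cons]
    rw [hs, tensorDerivation_mul, ih, tensorDerivation_ι, add_comm, Fin.sum_univ_succ,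
      Finset.mul_sum]
    congr 1
    · rw [hs]
      simp
    · refine Finset.sum_congr rfl fun i _ => ?_
      rw [hs]
      congr 2
      ext j
      simp [Function.update_apply]

end TensorAlgebra

end LiePBW

end

noncomputable section

namespace LiePBW

universe u v w

variable {k : Type u} {g : Type v} [Field k] [LieRing g] [LieAlgebra k g]
variable (h : LieSubalgebra k g)

/-! ### Universal properties -/

theorem exists_lieHom_quotient {L A : Type*} [LieRing L] [LieAlgebra k L] [LieRing A]
    [LieAlgebra k A] (I : LieIdeal k L) (f : L →ₗ⁅k⁆ A) (hf : I ≤ f.ker) :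
    ∃ F : (L ⧸ I) →ₗ⁅k⁆ A, ∀ x, F (LieSubmodule.Quotient.mk x) = f x := by
  refine ⟨{ Submodule.liftQ I.toSubmodule (f : L →ₗ[k] A) fun x hx => hf hx with
    map_lie' := ?_ }, fun x => rfl⟩
  rintro ⟨x⟩ ⟨y⟩
  exact f.map_lie x y

theorem exists_lieHom_freeLie {V A : Type*} [AddCommGroup V] [Module k V] [LieRing A]
    [LieAlgebra k A] (f : V →ₗ[k] A) :
    ∃ F : FreeLie k V →ₗ⁅k⁆ A, ∀ v, F (FreeLie.ι k V v) = f v := by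
  obtain ⟨F, hF⟩ := exists_lieHom_quotient (linearityIdeal k V) (FreeLieAlgebra.lift k f) <| by
    refine LieSubmodule.lieSpan_le.2 ?_
    rintro _ (⟨x, y, rfl⟩ | ⟨c, x, rfl⟩)
    · change FreeLieAlgebra.lift k f _ = 0
      simp
    · change FreeLieAlgebra.lift k f _ = 0
      simp
  exact ⟨F, fun v => (hF _).trans (FreeLieAlgebra.lift_of_apply _ v)⟩

/-- Nothing is asked of brackets with both entries outside h; this freedom lets ρ fall short of a
representation of g. -/
theorem exists_lieHom_nbhd {A : Type*} [LieRing A] [LieAlgebra k A] (f : g →ₗ[k] A)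
    (hf : ∀ (x : h) (y : g), f ⁅(x : g), y⁆ = ⁅f x, f y⁆) :
    ∃ F : Nbhd h →ₗ⁅k⁆ A, ∀ a, F (nbhdGen h a) = f a := by
  obtain ⟨F, hF⟩ := exists_lieHom_freeLie f
  obtain ⟨G, hG⟩ := exists_lieHom_quotient (nbhdIdeal h) F <| by
    refine LieSubmodule.lieSpan_le.2 ?_
    rintro _ ⟨x, y, rfl⟩
    change F _ = 0
    rw [map_sub, LieHom.map_lie, hF, hF, hF, hf, sub_self]
  exact ⟨G, fun a => (hG _).trans (hF a)⟩

theorem tensorToU_ι (a : g) : tensorToU h (TensorAlgebra.ι k a) =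
    UniversalEnvelopingAlgebra.ι k (nbhdGen h a) := by
  simp [tensorToU]

theorem tensorToInd_one : tensorToInd h 1 = Ind.mk h 1 := by
  simp [tensorToInd]

theorem tensorToInd_ι_mul (a : g) (t : TensorAlgebra k g) :
    tensorToInd h (TensorAlgebra.ι k a * t) =
      UniversalEnvelopingAlgebra.ι k (nbhdGen h a) • tensorToInd h t := by
  change Ind.mk h (tensorToU h _) = _ • Ind.mk h (tensorToU h t)
  rw [map_mul, tensorToU_ι, ← smul_eq_mul, map_smul]

theorem tensorToInd_ι_of_mem (x : h) : tensorToInd h (TensorAlgebra.ι k (x : g)) = 0 := by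
  change Ind.mk h (tensorToU h _) = 0
  rw [tensorToU_ι]
  exact (Submodule.Quotient.mk_eq_zero _).2 (Submodule.subset_span ⟨x, rfl⟩)

/-- A linear map from `U(h⁽¹⁾) / U(h⁽¹⁾) h` is given by operators that define an `h⁽¹⁾`-module and a
vector that `h` annihilates. -/
theorem exists_ind_lift {V : Type*} [AddCommGroup V] [Module k V] (f : g →ₗ[k] Module.End k V)
    (hf : ∀ (x : h) (y : g), f ⁅(x : g), y⁆ = ⁅f x, f y⁆) (v : V) (hv : ∀ x : h, f x v = 0) :
    ∃ F : Ind h →ₗ[k] V, ∀ t, F (tensorToInd h t) = TensorAlgebra.lift k f t v := by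
  obtain ⟨ρ, hρ⟩ := exists_lieHom_nbhd h f hf
  let Φ := UniversalEnvelopingAlgebra.lift k ρ
  let : Module (UniversalEnvelopingAlgebra k (Nbhd h)) V := Module.compHom V Φ.toRingHom
  have hsmul : ∀ (u : UniversalEnvelopingAlgebra k (Nbhd h)) (w : V), u • w = Φ u w :=
    fun _ _ => rfl
  -- The orbit map u ↦ u · v descends to the quotient because the generators of the left ideal kill
  -- v.
  let F : Ind h →ₗ[UniversalEnvelopingAlgebra k (Nbhd h)] V :=
    (leftIdeal h).liftQ (LinearMap.toSpanSingleton _ V v) <| by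
      refine Submodule.span_le.2 ?_
      rintro _ ⟨x, rfl⟩
      change UniversalEnvelopingAlgebra.ι k (nbhdIncl h x) • v = 0
      rw [hsmul, UniversalEnvelopingAlgebra.lift_ι_apply]
      exact (congrArg (fun T : Module.End k V => T v) (hρ x)).trans (hv x)
  refine ⟨{ F with map_smul' := fun c m => ?_ }, fun t => ?_⟩
  · change F (c • m) = c • F m
    rw [← algebraMap_smul (UniversalEnvelopingAlgebra k (Nbhd h)) c m, map_smul, hsmul,
      AlgHom.commutes, Module.algebraMap_end_apply]
  · change Φ (tensorToU h t) v = _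
    have : Φ.comp (tensorToU h) = TensorAlgebra.lift k f := by
      ext a : 2
      simp [tensorToU_ι, Φ, hρ]
    rw [← this]
    rfl

/-! ### The filtration -/

/-- Index shift: degree at most m is degree less than m + 1. -/
theorem mem_filtration {m : ℕ} {y : Ind h} :
    y ∈ filtration h m ↔ ∃ t ∈ tensorsLT k g (m + 1), tensorToInd h t = y := Iff.rfl

/-- Moving x to the right through t produces only commutators [x, aᵢ] ∈ g, which keep the degree; at
the right end x dies in the quotient. So a factor from h costs one degree. -/
theorem exists_lie_tensorToInd (x : h) {i : ℕ} {t : TensorAlgebra k g}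
    (ht : t ∈ tensorPow k g i) : ∃ t' ∈ tensorPow k g i,
      tensorToInd h (TensorAlgebra.ι k (x : g) * t) = tensorToInd h t' := by
  obtain ⟨t', ht', e⟩ := tensorToU_commutator h x i t ht
  refine ⟨t', ht', ?_⟩
  change Ind.mk h (tensorToU h _) = Ind.mk h (tensorToU h t')
  rw [map_mul, tensorToU_ι]
  refine (congrArg (Ind.mk h) e).trans ?_
  rw [map_add, add_eq_left]
  exact (Submodule.Quotient.mk_eq_zero _).2
    (Submodule.smul_mem _ _ (Submodule.subset_span ⟨x, rfl⟩))

theorem mem_of_normalProj_eq_zero {a : g} (ha : normalProj h a = 0) : a ∈ h :=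
  (LieSubmodule.Quotient.mk_eq_zero _).1 ha

theorem normalProj_coe (x : h) : normalProj h (x : g) = 0 :=
  (LieSubmodule.Quotient.mk_eq_zero _).2 x.2

theorem normalProj_lie (x : h) (a : g) : normalProj h ⁅(x : g), a⁆ = ⁅x, normalProj h a⁆ := rfl

/-- The projection `T(g) → T(n)`. -/
def tensorNormal : TensorAlgebra k g →ₐ[k] TensorAlgebra k (normalModule h) :=
  tensorMap (normalProj h : g →ₗ[k] normalModule h)

theorem tensorNormal_ι (a : g) : tensorNormal h (TensorAlgebra.ι k a) =
    TensorAlgebra.ι k (normalProj h a) := tensorMap_ι _ a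

theorem tensorNormal_mem {i : ℕ} {t : TensorAlgebra k g} (ht : t ∈ tensorPow k g i) :
    tensorNormal h t ∈ tensorPow k (normalModule h) i := tensorMap_mem _ ht

theorem exists_normalSection : ∃ σ : normalModule h →ₗ[k] g, ∀ v, normalProj h (σ v) = v := by
  obtain ⟨σ, hσ⟩ := LinearMap.exists_rightInverse_of_surjective
    (normalProj h : g →ₗ[k] normalModule h)
    (LinearMap.range_eq_top.2 (LieSubmodule.Quotient.surjective_mk' _))
  exact ⟨σ, fun v => DFunLike.congr_fun hσ v⟩

theorem exists_tensorNormal_eq {i : ℕ} {X : TensorAlgebra k (normalModule h)}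
    (hX : X ∈ tensorPow k (normalModule h) i) :
    ∃ t ∈ tensorPow k g i, tensorNormal h t = X := by
  obtain ⟨σ, hσ⟩ := exists_normalSection h
  refine ⟨tensorMap σ X, tensorMap_mem σ hX, ?_⟩
  have : (tensorNormal h).comp (tensorMap σ) = AlgHom.id k _ := by
    ext v
    simp [tensorNormal_ι, hσ]
  exact DFunLike.congr_fun this X

/-- A homogeneous tensor that vanishes in `T(n)` is, in `U(h⁽¹⁾) / U(h⁽¹⁾) h`, of lower degree. -/
theorem exists_tensorToInd_eq_of_tensorNormal_eq_zero {i : ℕ} {t : TensorAlgebra k g}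
    (ht : t ∈ tensorPow k g i) (h0 : tensorNormal h t = 0) :
    ∃ w ∈ tensorsLT k g i, tensorToInd h w = tensorToInd h t := by
  obtain ⟨σ, hσ⟩ := exists_normalSection h
  -- Vanishing in T(n) does not pass to tensor factors, so the induction compares an arbitrary t
  -- with its normal form under the section σ.
  suffices ∃ w ∈ tensorsLT k g i,
      tensorToInd h w = tensorToInd h (t - tensorMap σ (tensorNormal h t)) by
    rwa [h0, map_zero, sub_zero] at this
  clear h0
  induction ht using Submodule.pow_induction_on_left' with
  | algebraMap r => exact ⟨0, zero_mem _, by simp⟩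
  | add a b i _ _ iha ihb =>
    obtain ⟨w, hw, ew⟩ := iha
    obtain ⟨w', hw', ew'⟩ := ihb
    refine ⟨w + w', add_mem hw hw', ?_⟩
    rw [map_add, ew, ew', ← map_add, map_add (tensorNormal h), map_add (tensorMap σ),
      add_sub_add_comm]
  | mem_mul m hm i t ht iht =>
    obtain ⟨a, rfl⟩ := hm
    obtain ⟨w, hw, ew⟩ := iht
    -- With t̂ the normal form of t: a t − σ(ā) t̂ = σ(ā)(t − t̂) + (a − σ(ā)) t. Induction lowers
    -- the first term; in the second the left factor lies in h.
    have hx : a - σ (normalProj h a) ∈ h := mem_of_normalProj_eq_zero h (by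
      rw [map_sub, hσ, sub_self])
    obtain ⟨t', ht', et⟩ := exists_lie_tensorToInd h ⟨_, hx⟩ ht
    refine ⟨TensorAlgebra.ι k (σ (normalProj h a)) * w + t',
      add_mem (ι_mul_mem_tensorsLT _ hw) (tensorPow_le_tensorsLT i.lt_succ_self ht'), ?_⟩
    rw [map_add, tensorToInd_ι_mul, ew, ← tensorToInd_ι_mul, ← et, ← map_add, map_mul, map_mul,
      tensorNormal_ι, tensorMap_ι, map_sub]
    congr 1
    noncomm_ring

end LiePBW

end

noncomputable section

namespace LiePBW

universe u v w

variable {k : Type u} {g : Type v} [Field k] [LieRing g] [LieAlgebra k g]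
variable {h : LieSubalgebra k g}

/-! ### The action on the tensor algebra of `n` -/

variable (ρ : g →ₗ[k] Module.End k (normalModule h))

/-- The operators `X ↦ ā ⊗ X + a · X` on `T(n)`. -/
def tensorAction : g →ₗ[k] Module.End k (TensorAlgebra k (normalModule h)) where
  toFun a := LinearMap.mulLeft k (TensorAlgebra.ι k (normalProj h a)) + tensorDerivation (ρ a)
  map_add' a b := by
    ext X
    simp only [map_add, tensorDerivation_add, LinearMap.add_apply, LinearMap.mulLeft_apply, add_mul]
    abel
  map_smul' c a := by
    ext X
    simp [tensorDerivation_smul]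

theorem tensorAction_apply (a : g) (X : TensorAlgebra k (normalModule h)) :
    tensorAction ρ a X =
      TensorAlgebra.ι k (normalProj h a) * X + tensorDerivation (ρ a) X := rfl

theorem tensorAction_coe (x : h) : tensorAction ρ (x : g) = tensorDerivation (ρ x) := by
  ext X
  rw [tensorAction_apply, normalProj_coe, map_zero, zero_mul, zero_add]

/-- The linear map `T(g) → T(n)` given by acting on `1`. -/
def tensorOrbit : TensorAlgebra k g →ₗ[k] TensorAlgebra k (normalModule h) where
  toFun t := TensorAlgebra.lift k (tensorAction ρ) t 1
  map_add' s t := by rw [map_add, LinearMap.add_apply]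
  map_smul' c t := by rw [map_smul, LinearMap.smul_apply, RingHom.id_apply]

theorem tensorOrbit_algebraMap (c : k) :
    tensorOrbit ρ (algebraMap k _ c) = algebraMap k _ c := by
  change TensorAlgebra.lift k (tensorAction ρ) _ 1 = _
  rw [AlgHom.commutes, Module.algebraMap_end_apply, Algebra.algebraMap_eq_smul_one]

theorem tensorOrbit_one : tensorOrbit ρ 1 = 1 := by
  simpa using tensorOrbit_algebraMap ρ 1

theorem tensorOrbit_ι_mul (a : g) (t : TensorAlgebra k g) :
    tensorOrbit ρ (TensorAlgebra.ι k a * t) = tensorAction ρ a (tensorOrbit ρ t) := by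
  change TensorAlgebra.lift k (tensorAction ρ) _ 1 = _
  rw [map_mul, TensorAlgebra.lift_ι_apply]
  rfl

/-- Triangularity: derivations preserve degree, so only the multiplications by ā contribute to the
leading term. -/
theorem tensorOrbit_sub_tensorNormal_mem {i : ℕ} {t : TensorAlgebra k g}
    (ht : t ∈ tensorPow k g i) :
    tensorOrbit ρ t - tensorNormal h t ∈ tensorsLT k (normalModule h) i := by
  induction ht using Submodule.pow_induction_on_left' with
  | algebraMap r => simp [tensorOrbit_algebraMap]
  | add a b i _ _ iha ihb =>
    rw [map_add, map_add, add_sub_add_comm]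
    exact add_mem iha ihb
  | mem_mul m hm i t ht iht =>
    obtain ⟨a, rfl⟩ := hm
    rw [tensorOrbit_ι_mul, tensorAction_apply, map_mul, tensorNormal_ι, add_sub_right_comm,
      ← mul_sub]
    refine add_mem (ι_mul_mem_tensorsLT _ iht) (tensorDerivation_mem_tensorsLT _ ?_)
    rw [← sub_add_cancel (tensorOrbit ρ t) (tensorNormal h t)]
    exact add_mem (tensorsLT_mono i.le_succ iht)
      (tensorPow_le_tensorsLT i.lt_succ_self (tensorNormal_mem h ht))

theorem tensorProj_tensorOrbit {i : ℕ} {t : TensorAlgebra k g} (ht : t ∈ tensorPow k g i) :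
    tensorProj k _ i (tensorOrbit ρ t) = tensorNormal h t := by
  have := tensorProj_eq_zero (tensorOrbit_sub_tensorNormal_mem ρ ht)
  rwa [map_sub, tensorProj_of_mem (tensorNormal_mem h ht), sub_eq_zero] at this

theorem tensorOrbit_mem {i : ℕ} {t : TensorAlgebra k g} (ht : t ∈ tensorsLT k g i) :
    tensorOrbit ρ t ∈ tensorsLT k (normalModule h) i := by
  have : tensorsLT k g i ≤ (tensorsLT k (normalModule h) i).comap (tensorOrbit ρ) := by
    refine iSup_le fun l t ht => ?_
    rw [Submodule.mem_comap, ← sub_add_cancel (tensorOrbit ρ t) (tensorNormal h t)]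
    exact add_mem (tensorsLT_mono l.2.le (tensorOrbit_sub_tensorNormal_mem ρ ht))
      (tensorPow_le_tensorsLT l.2 (tensorNormal_mem h ht))
  exact this ht

theorem exists_tensorOrbit_eq {i : ℕ} {X : TensorAlgebra k (normalModule h)}
    (hX : X ∈ tensorsLT k (normalModule h) i) :
    ∃ t ∈ tensorsLT k g i, tensorOrbit ρ t = X := by
  induction i generalizing X with
  | zero =>
    rw [tensorsLT_zero, Submodule.mem_bot] at hX
    exact ⟨0, zero_mem _, by rw [hX, map_zero]⟩
  | succ i ih =>
    rw [tensorsLT_succ] at hX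
    obtain ⟨X₀, h₀, X₁, h₁, rfl⟩ := Submodule.mem_sup.1 hX
    obtain ⟨t, ht, rfl⟩ := exists_tensorNormal_eq h h₁
    -- The orbit of t has the right leading term; s corrects the lower-degree error.
    obtain ⟨s, hs, es⟩ := ih (sub_mem h₀ (tensorOrbit_sub_tensorNormal_mem ρ ht))
    refine ⟨s + t, add_mem (tensorsLT_mono i.le_succ hs)
      (tensorPow_le_tensorsLT i.lt_succ_self ht), ?_⟩
    rw [map_add, es]
    abel

/-! ### The isomorphism of M with T(n) and the induced splittings -/

section

variable {ρ} (hρ : ∀ (x : h) (y : g), ρ ⁅(x : g), y⁆ = ⁅ρ x, ρ y⁆)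
  (hρ' : ∀ (x : h) (v : normalModule h), ρ x v = ⁅x, v⁆)

include hρ hρ' in
-- x acts by a pure derivation. Its commutator with left multiplication by ȳ is left multiplication
-- by x · ȳ, the class of [x, y]; the derivation parts match by the hypothesis on ρ.
theorem tensorAction_lie (x : h) (y : g) :
    tensorAction ρ ⁅(x : g), y⁆ = ⁅tensorAction ρ (x : g), tensorAction ρ y⁆ := by
  have e : tensorDerivation (ρ ⁅(x : g), y⁆) =
      ⁅tensorDerivation (ρ x), tensorDerivation (ρ y)⁆ := by
    rw [hρ, tensorDerivation_lie]
  rw [tensorAction_coe]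
  ext X
  rw [tensorAction_apply, e]
  simp only [LieRing.of_associative_ring_bracket, LinearMap.sub_apply, Module.End.mul_apply,
    tensorAction_apply, map_add, tensorDerivation_mul, tensorDerivation_ι, hρ', normalProj_lie]
  abel

include hρ hρ' in
/-- The map `T(g) → T(n)` factors over `U(h⁽¹⁾) / U(h⁽¹⁾) h`. -/
theorem exists_indOrbit : ∃ F : Ind h →ₗ[k] TensorAlgebra k (normalModule h),
    ∀ t, F (tensorToInd h t) = tensorOrbit ρ t :=
  exists_ind_lift h (tensorAction ρ) (tensorAction_lie hρ hρ') 1 fun x => by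
    rw [tensorAction_coe, tensorDerivation_one]

include hρ hρ' in
-- Injectivity of M → T(n), by descent on degree: a vanishing orbit has vanishing leading term, so
-- the top component of t can be replaced by lower-degree tensors without changing its class in M.
theorem tensorToInd_eq_zero_of_tensorOrbit_eq_zero {t : TensorAlgebra k g}
    (ht : tensorOrbit ρ t = 0) : tensorToInd h t = 0 := by
  obtain ⟨F, hF⟩ := exists_indOrbit hρ hρ'
  obtain ⟨i, hi⟩ := exists_mem_tensorsLT t
  induction i generalizing t with
  | zero =>
    rw [tensorsLT_zero, Submodule.mem_bot] at hi
    rw [hi, map_zero]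
  | succ i ih =>
    rw [tensorsLT_succ] at hi
    obtain ⟨t₀, h₀, t₁, h₁, rfl⟩ := Submodule.mem_sup.1 hi
    have h0 : tensorNormal h t₁ = 0 := by
      rw [← tensorProj_tensorOrbit ρ h₁, eq_neg_of_add_eq_zero_right ((map_add _ _ _).symm.trans ht),
        map_neg, tensorProj_eq_zero (tensorOrbit_mem ρ h₀), neg_zero]
    obtain ⟨w, hw, ew⟩ := exists_tensorToInd_eq_of_tensorNormal_eq_zero h h₁ h0
    rw [map_add, ← ew, ← map_add]
    refine ih ?_ (add_mem h₀ hw)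
    -- The replacement leaves the orbit unchanged because the orbit depends only on the class in M.
    rw [← hF, map_add, ew, ← map_add, hF, ht]

include hρ hρ' in
/-- The inverse `T(n) → U(h⁽¹⁾) / U(h⁽¹⁾) h`. -/
theorem exists_tensorSection : ∃ S : TensorAlgebra k (normalModule h) →ₗ[k] Ind h,
    ∀ t, S (tensorOrbit ρ t) = tensorToInd h t := by
  obtain ⟨r, hr⟩ := LinearMap.exists_rightInverse_of_surjective (tensorOrbit ρ)
    (LinearMap.range_eq_top.2 fun X => by
      obtain ⟨i, hi⟩ := exists_mem_tensorsLT X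
      obtain ⟨t, -, rfl⟩ := exists_tensorOrbit_eq ρ hi
      exact ⟨t, rfl⟩)
  -- Independent of the chosen right inverse r, since the kernel of `tensorOrbit` dies in M.
  refine ⟨tensorToInd h ∘ₗ r, fun t => ?_⟩
  rw [LinearMap.comp_apply, ← sub_eq_zero, ← map_sub]
  refine tensorToInd_eq_zero_of_tensorOrbit_eq_zero hρ hρ' ?_
  rw [map_sub, sub_eq_zero]
  exact DFunLike.congr_fun hr _

/-- Expanding the action on the left gives the recursion S(ā ⊗ X) + S(a · X) = a · S(X). -/
theorem tensorSection_tensorAction {S : TensorAlgebra k (normalModule h) →ₗ[k] Ind h}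
    (hS : ∀ t, S (tensorOrbit ρ t) = tensorToInd h t) (a : g)
    (X : TensorAlgebra k (normalModule h)) :
    S (tensorAction ρ a X) = UniversalEnvelopingAlgebra.ι k (nbhdGen h a) • S X := by
  obtain ⟨i, hi⟩ := exists_mem_tensorsLT X
  obtain ⟨t, -, rfl⟩ := exists_tensorOrbit_eq ρ hi
  rw [← tensorOrbit_ι_mul, hS, hS, tensorToInd_ι_mul]

theorem tensorSection_mem {S : TensorAlgebra k (normalModule h) →ₗ[k] Ind h}
    (hS : ∀ t, S (tensorOrbit ρ t) = tensorToInd h t) {m : ℕ}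
    {X : TensorAlgebra k (normalModule h)} (hX : X ∈ tensorsLT k (normalModule h) (m + 1)) :
    S X ∈ filtration h m := by
  obtain ⟨t, ht, rfl⟩ := exists_tensorOrbit_eq ρ hX
  exact (mem_filtration h).2 ⟨t, ht, (hS t).symm⟩

include hρ hρ' in
theorem exists_splitting {S : TensorAlgebra k (normalModule h) →ₗ[k] Ind h}
    (hS : ∀ t, S (tensorOrbit ρ t) = tensorToInd h t) (m : ℕ) :
    ∃ σ : filtrationQuotient h m →ₗ⁅k,h⁆ filtration h (m + 1), IsSplitting h m σ ∧
      ∀ (a : Fin (m + 1) → g) (y : filtration h (m + 1)),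
        (y : Ind h) = tensorToInd h (TensorAlgebra.tprod k g (m + 1) a) →
        (σ (LieSubmodule.Quotient.mk' _ y) : Ind h) =
          S (TensorAlgebra.tprod k _ (m + 1) fun i => normalProj h (a i)) := by
  obtain ⟨F, hF⟩ := exists_indOrbit hρ hρ'
  have hFlie : ∀ (x : h) (y : filtration h (m + 1)),
      F ⁅x, (y : Ind h)⁆ = tensorDerivation (ρ x) (F y) := by
    rintro x ⟨_, t, -, rfl⟩
    change F (UniversalEnvelopingAlgebra.ι k (nbhdGen h x) • tensorToInd h t) =
      tensorDerivation (ρ x) (F (tensorToInd h t))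
    rw [← tensorToInd_ι_mul, hF, hF, tensorOrbit_ι_mul, tensorAction_coe]
  -- Pass to T(n), keep the component of degree m + 1, and return. This kills Fᵐ and changes an
  -- element only by an element of Fᵐ.
  let p : filtration h (m + 1) →ₗ[k] filtration h (m + 1) :=
    LinearMap.codRestrict (filtration h (m + 1)).toSubmodule
      (S ∘ₗ tensorProj k _ (m + 1) ∘ₗ F ∘ₗ (filtration h (m + 1)).toSubmodule.subtype)
      fun y => tensorSection_mem hS
        (tensorPow_le_tensorsLT (Nat.lt_succ_self _) (tensorProj_mem _ _))
  have hp : ∀ y : filtration h (m + 1), (p y : Ind h) = S (tensorProj k _ (m + 1) (F y)) :=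
    fun _ => rfl
  have hker : ((filtration h m).comap (filtration h (m + 1)).incl).toSubmodule ≤
      LinearMap.ker p := by
    rintro ⟨y, hy⟩ ⟨t, ht, rfl⟩
    rw [LinearMap.mem_ker]
    ext
    rw [hp]
    change S (tensorProj k _ (m + 1) (F (tensorToInd h t))) = 0
    rw [hF, tensorProj_eq_zero (tensorOrbit_mem ρ ht), map_zero]
  let σ : filtrationQuotient h m →ₗ⁅k,h⁆ filtration h (m + 1) :=
    { Submodule.liftQ _ p hker with
      map_lie' := by
        rintro x ⟨y⟩
        change p ⁅x, y⁆ = ⁅x, p y⁆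
        ext
        rw [hp, LieSubmodule.coe_bracket, LieSubmodule.coe_bracket, hp, hFlie,
          tensorProj_tensorDerivation, ← tensorAction_coe, tensorSection_tensorAction hS]
        rfl }
  have hσ : ∀ y : filtration h (m + 1), σ (LieSubmodule.Quotient.mk' _ y) = p y := fun _ => rfl
  refine ⟨σ, fun q => ?_, fun a y hy => ?_⟩
  · obtain ⟨y, rfl⟩ := LieSubmodule.Quotient.surjective_mk' _ q
    rw [hσ, ← sub_eq_zero, ← map_sub, LieSubmodule.Quotient.mk_eq_zero, ← neg_mem_iff, neg_sub]
    change (y : Ind h) - p y ∈ filtration h m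
    rw [hp]
    obtain ⟨_, t, ht, rfl⟩ := y
    change tensorToInd h t - S (tensorProj k _ (m + 1) (F (tensorToInd h t))) ∈ filtration h m
    rw [hF, ← hS, ← map_sub]
    exact tensorSection_mem hS (sub_tensorProj_mem (tensorOrbit_mem ρ ht))
  · rw [hσ, hp, hy, hF, tensorProj_tensorOrbit ρ (tprod_mem_tensorPow a), tensorNormal,
      tensorMap_tprod]
    rfl

end

end LiePBW

end

noncomputable section

namespace LiePBW

universe u v w

/-! ### Coinduced modules -/

section Coinduced

variable (k : Type u) (L : Type v) [Field k] [LieRing L] [LieAlgebra k L]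
variable (W : Type w) [AddCommGroup W] [Module k W]

/-- The `L`-module of linear maps `U(L) → W`, on which `L` acts by right multiplication in the
argument. -/
def Coinduced : Type _ := UniversalEnvelopingAlgebra k L →ₗ[k] W

instance : AddCommGroup (Coinduced k L W) :=
  inferInstanceAs (AddCommGroup (UniversalEnvelopingAlgebra k L →ₗ[k] W))

instance : Module k (Coinduced k L W) :=
  inferInstanceAs (Module k (UniversalEnvelopingAlgebra k L →ₗ[k] W))

variable {k L W}

/-- The linear map underlying an element of the coinduced module. -/
def Coinduced.equiv : Coinduced k L W ≃ₗ[k] (UniversalEnvelopingAlgebra k L →ₗ[k] W) :=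
  LinearEquiv.refl k _

/-- Evaluation of elements of the coinduced module. -/
def Coinduced.eval (a : UniversalEnvelopingAlgebra k L) : Coinduced k L W →ₗ[k] W :=
  LinearMap.applyₗ a ∘ₗ (Coinduced.equiv : Coinduced k L W ≃ₗ[k] _).toLinearMap

theorem Coinduced.eval_equiv_symm (a : UniversalEnvelopingAlgebra k L)
    (f : UniversalEnvelopingAlgebra k L →ₗ[k] W) :
    Coinduced.eval a (Coinduced.equiv.symm f) = f a := rfl

theorem Coinduced.ext {v w : Coinduced k L W}
    (hvw : ∀ a, Coinduced.eval a v = Coinduced.eval a w) : v = w :=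
  Coinduced.equiv.injective (LinearMap.ext hvw)

theorem Coinduced.eval_add (a b : UniversalEnvelopingAlgebra k L) (v : Coinduced k L W) :
    Coinduced.eval (a + b) v = Coinduced.eval a v + Coinduced.eval b v :=
  map_add (Coinduced.equiv v) a b

theorem Coinduced.eval_smul (c : k) (a : UniversalEnvelopingAlgebra k L) (v : Coinduced k L W) :
    Coinduced.eval (c • a) v = c • Coinduced.eval a v :=
  map_smul (Coinduced.equiv v) c a

instance : Bracket L (Coinduced k L W) where
  bracket x v := Coinduced.equiv.symm
    (Coinduced.equiv v ∘ₗ LinearMap.mulRight k (UniversalEnvelopingAlgebra.ι k x))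

theorem Coinduced.eval_lie (a : UniversalEnvelopingAlgebra k L) (x : L) (v : Coinduced k L W) :
    Coinduced.eval a ⁅x, v⁆ = Coinduced.eval (a * UniversalEnvelopingAlgebra.ι k x) v := rfl

instance : LieRingModule L (Coinduced k L W) where
  add_lie x y v := Coinduced.ext fun a => by
    rw [map_add]
    simp only [Coinduced.eval_lie, map_add, mul_add, Coinduced.eval_add]
  lie_add x v w := Coinduced.ext fun a => by
    simp only [Coinduced.eval_lie, map_add]
  leibniz_lie x y v := Coinduced.ext fun a => by
    rw [map_add]
    simp only [Coinduced.eval_lie]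
    rw [← Coinduced.eval_add, LieHom.map_lie, LieRing.of_associative_ring_bracket]
    congr 2
    noncomm_ring

instance : LieModule k L (Coinduced k L W) where
  smul_lie c x v := Coinduced.ext fun a => by
    rw [Coinduced.eval_lie, map_smul, mul_smul_comm, Coinduced.eval_smul, map_smul,
      Coinduced.eval_lie]
  lie_smul c x v := Coinduced.ext fun a => by
    rw [Coinduced.eval_lie, map_smul, map_smul, Coinduced.eval_lie]

variable {A : Type*} [AddCommGroup A] [Module k A] [LieRingModule L A] [LieModule k L A]

/-- Frobenius reciprocity. -/
def Coinduced.lift (f : A →ₗ[k] W) : A →ₗ⁅k,L⁆ Coinduced k L W where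
  toFun t := Coinduced.equiv.symm
    (f ∘ₗ (UniversalEnvelopingAlgebra.lift k (LieModule.toEnd k L A)).toLinearMap.flip t)
  map_add' s t := Coinduced.ext fun a => by
    simp only [Coinduced.eval_equiv_symm, map_add, LinearMap.comp_apply, LinearMap.add_apply]
  map_smul' c t := Coinduced.ext fun a => by
    simp only [Coinduced.eval_equiv_symm, map_smul, LinearMap.comp_apply, LinearMap.smul_apply,
      RingHom.id_apply]
  map_lie' := fun {x t} => Coinduced.ext fun a => by
    simp only [Coinduced.eval_equiv_symm, Coinduced.eval_lie, LinearMap.comp_apply,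
      LinearMap.flip_apply, AlgHom.toLinearMap_apply, map_mul,
      UniversalEnvelopingAlgebra.lift_ι_apply, Module.End.mul_apply, LieModule.toEnd_apply_apply]

theorem Coinduced.eval_one_lift (f : A →ₗ[k] W) (t : A) :
    Coinduced.eval 1 (Coinduced.lift (L := L) f t) = f t := by
  simp [Coinduced.lift, Coinduced.eval_equiv_symm]

theorem Coinduced.hom_ext {F G : A →ₗ⁅k,L⁆ Coinduced k L W}
    (hFG : ∀ t, Coinduced.eval 1 (F t) = Coinduced.eval 1 (G t)) : F = G := by
  -- Equivariance extended to U(L): at b = 1 it shows that evaluation at 1 determines H.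
  have key : ∀ (a : UniversalEnvelopingAlgebra k L) (H : A →ₗ⁅k,L⁆ Coinduced k L W) (t : A)
      (b : UniversalEnvelopingAlgebra k L), Coinduced.eval (b * a) (H t) =
        Coinduced.eval b
          (H (UniversalEnvelopingAlgebra.lift k (LieModule.toEnd k L A) a t)) := by
    intro a H
    induction a using enveloping_induction with
    | hs c =>
      intro t b
      rw [AlgHom.commutes, Module.algebraMap_end_apply, map_smul, map_smul, ← Algebra.commutes,
        ← Algebra.smul_def, Coinduced.eval_smul]
    | hι x =>
      intro t b
      rw [UniversalEnvelopingAlgebra.lift_ι_apply, LieModule.toEnd_apply_apply, H.map_lie,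
        Coinduced.eval_lie]
    | hm a b ha hb =>
      intro t c
      rw [← mul_assoc, hb, ha, map_mul, Module.End.mul_apply]
    | ha a b ha hb =>
      intro t c
      rw [mul_add, Coinduced.eval_add, ha, hb, map_add, LinearMap.add_apply, map_add, map_add]
  ext t
  refine Coinduced.ext fun a => ?_
  rw [← one_mul a, key, key, hFG]

end Coinduced

/-! ### The projection to `n` on elements of degree at most one -/

section Projection

variable {k : Type u} {g : Type v} [Field k] [LieRing g] [LieAlgebra k g]
variable (h : LieSubalgebra k g)

/-- The map `n → U(h⁽¹⁾) / U(h⁽¹⁾) h` has a left inverse that annihilates the class of `1`. -/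
theorem exists_ind_projection : ∃ F : Ind h →ₗ[k] normalModule h,
    F (Ind.mk h 1) = 0 ∧ ∀ a : g, F (tensorToInd h (TensorAlgebra.ι k a)) = normalProj h a := by
  -- P is only linear; equivariance is supplied later by coinduction.
  obtain ⟨P, hP⟩ := LinearMap.exists_leftInverse_of_injective (h.incl' : h →ₗ[k] g)
    (LinearMap.ker_eq_bot.2 Subtype.val_injective)
  replace hP : ∀ x : h, P (x : g) = x := fun x => DFunLike.congr_fun hP x
  -- The augmentation of U(h) in the k-coordinate: an h-invariant vector to serve as the image of
  -- the class of 1.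
  let v₀ : Coinduced k h (k × normalModule h) := Coinduced.equiv.symm
    (LinearMap.inl k k (normalModule h) ∘ₗ
      (UniversalEnvelopingAlgebra.lift k (0 : h →ₗ⁅k⁆ k)).toLinearMap)
  have hv₀ : ∀ a, Coinduced.eval a v₀ =
    (UniversalEnvelopingAlgebra.lift k (0 : h →ₗ⁅k⁆ k) a, 0) := fun _ => rfl
  have hvι : ∀ (a) (x : h), Coinduced.eval (a * UniversalEnvelopingAlgebra.ι k x) v₀ = 0 := by
    intro a x
    rw [hv₀, map_mul, UniversalEnvelopingAlgebra.lift_ι_apply, LieHom.zero_apply, mul_zero,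
      Prod.mk_zero_zero]
  have hv₀' : ∀ x : h, ⁅x, v₀⁆ = 0 := fun x => Coinduced.ext fun a => by
    rw [Coinduced.eval_lie, hvι, map_zero]
  let i : g →ₗ⁅k,h⁆ Coinduced k h (k × normalModule h) := Coinduced.lift
    (LinearMap.inr k k (normalModule h) ∘ₗ (normalProj h : g →ₗ[k] normalModule h))
  -- The first term makes β(x, v) the value at 1 of x · v for x ∈ h; the second vanishes on h and
  -- makes β(a, v₀) = (0, ā). Frobenius reciprocity turns both into identities of h-maps.
  let β : g →ₗ[k] Coinduced k h (k × normalModule h) →ₗ[k] (k × normalModule h) := LinearMap.mk₂ k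
    (fun a v => Coinduced.eval (UniversalEnvelopingAlgebra.ι k (P a)) v +
      LinearMap.inr k k _ ((Coinduced.eval 1 v).1 • normalProj h a))
    (fun a b v => by
      simp only [map_add, Coinduced.eval_add, smul_add]
      abel)
    (fun c a v => by
      simp only [map_smul, Coinduced.eval_smul, smul_add]
      rw [smul_comm])
    (fun a v w => by
      simp only [map_add, Prod.fst_add, add_smul]
      abel)
    (fun c a v => by
      simp only [map_smul, Prod.smul_fst, smul_add, smul_assoc])
  have hβ : ∀ a v, β a v = Coinduced.eval (UniversalEnvelopingAlgebra.ι k (P a)) v +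
    LinearMap.inr k k _ ((Coinduced.eval 1 v).1 • normalProj h a) := fun _ _ => rfl
  let Φ : g ⊗[k] Coinduced k h (k × normalModule h) →ₗ⁅k,h⁆ Coinduced k h (k × normalModule h) := Coinduced.lift (TensorProduct.lift β)
  have hΦ : ∀ a v, Coinduced.eval 1 (Φ (a ⊗ₜ v)) = β a v := fun a v =>
    (Coinduced.eval_one_lift _ _).trans (TensorProduct.lift.tmul _ _)
  let f : g →ₗ[k] Module.End k (Coinduced k h (k × normalModule h)) := TensorProduct.curry (Φ : g ⊗[k] Coinduced k h (k × normalModule h) →ₗ[k] Coinduced k h (k × normalModule h))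
  have hf : ∀ a v, f a v = Φ (a ⊗ₜ v) := fun _ _ => rfl
  have hfx : ∀ (x : h) (v : Coinduced k h (k × normalModule h)), f x v = ⁅x, v⁆ := by
    intro x v
    have : Φ.comp (TensorProduct.LieModule.map h.incl' LieModuleHom.id) =
        LieModule.toModuleHom k h (Coinduced k h (k × normalModule h)) := by
      refine Coinduced.hom_ext fun t => ?_
      induction t using TensorProduct.induction_on with
      | zero => simp
      | tmul x v =>
        rw [LieModuleHom.comp_apply, TensorProduct.LieModule.map_tmul,
          LieModule.toModuleHom_apply, Coinduced.eval_lie, one_mul]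
        refine (hΦ _ _).trans ?_
        change β (x : g) v = _
        rw [hβ, hP, normalProj_coe, smul_zero, map_zero, add_zero]
      | add a b ha hb => rw [map_add, map_add, map_add, map_add, ha, hb]
    exact DFunLike.congr_fun this (x ⊗ₜ v)
  have hfl : ∀ (x : h) (y : g), f ⁅(x : g), y⁆ = ⁅f x, f y⁆ := by
    intro x y
    ext v
    rw [LieRing.of_associative_ring_bracket, LinearMap.sub_apply, Module.End.mul_apply,
      Module.End.mul_apply, hfx, hfx, hf, hf, hf, ← LieModuleHom.map_lie,
      TensorProduct.LieModule.lie_tmul_right, map_add, add_sub_cancel_right]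
    rfl
  have hfi : ∀ a, f a v₀ = i a := by
    intro a
    let G : g →ₗ⁅k,h⁆ Coinduced k h (k × normalModule h) :=
      { (f.flip v₀ : g →ₗ[k] Coinduced k h (k × normalModule h)) with
        map_lie' := fun {x y} => by
          change f ⁅(x : g), y⁆ v₀ = ⁅x, f y v₀⁆
          rw [hfl, LieRing.of_associative_ring_bracket, LinearMap.sub_apply, Module.End.mul_apply,
            Module.End.mul_apply, hfx, hfx, hv₀', map_zero, sub_zero] }
    have : G = i := by
      refine Coinduced.hom_ext fun a => ?_
      refine (hΦ a v₀).trans (Eq.trans ?_ (Coinduced.eval_one_lift _ a).symm)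
      rw [hβ, ← one_mul (UniversalEnvelopingAlgebra.ι k (P a)), hvι, hv₀, map_one, one_smul,
        zero_add]
      rfl
    exact DFunLike.congr_fun this a
  obtain ⟨F, hF⟩ := exists_ind_lift h f hfl v₀ fun x => (hfx x v₀).trans (hv₀' x)
  -- Act on v₀, evaluate at 1, and take the n-coordinate.
  refine ⟨LinearMap.snd k k (normalModule h) ∘ₗ Coinduced.eval 1 ∘ₗ F, ?_, fun a => ?_⟩
  · rw [← tensorToInd_one, LinearMap.comp_apply, LinearMap.comp_apply, hF, map_one,
      Module.End.one_apply, hv₀]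
    rfl
  · rw [LinearMap.comp_apply, LinearMap.comp_apply, hF, TensorAlgebra.lift_ι_apply, hfi]
    exact congrArg Prod.snd (Coinduced.eval_one_lift _ a)

end Projection

end LiePBW

end

noncomputable section

namespace LiePBW

universe u v w

variable {k : Type u} {g : Type v} [Field k] [LieRing g] [LieAlgebra k g]
variable (h : LieSubalgebra k g)

/-! ### The class `α` -/

/-- α is the image of the action map under the connecting homomorphism, so it vanishes iff the
action map comes from Hom(g ⊗ n, n). -/
theorem alpha_eq_zero_iff_exists_hom : alpha h = 0 ↔
    ∃ f : (tensorSequence h (normalModule h)).X₂ ⟶ repObj k h (normalModule h),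
      (tensorSequence h (normalModule h)).f ≫ f =
        repHom k h (LieModule.toModuleHom k h (normalModule h)) := by
  let := HasExt.standard (ModuleCat.{v} (UniversalEnvelopingAlgebra k h))
  constructor
  · intro h0
    obtain ⟨x, hx⟩ := Ext.contravariant_sequence_exact₁ (tensorSequence_shortExact h _) _ _
      (add_zero 1) h0
    obtain ⟨f, rfl⟩ := (Ext.mk₀_bijective _ _).2 x
    refine ⟨f, (Ext.mk₀_bijective _ _).1 ?_⟩
    rw [← hx, Ext.mk₀_comp_mk₀]
  · rintro ⟨f, hf⟩
    change (tensorSequence_shortExact h (normalModule h)).extClass.comp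
      (Ext.mk₀ (repHom k h (LieModule.toModuleHom k h (normalModule h)))) (add_zero 1) = 0
    rw [← hf, ← Ext.mk₀_comp_mk₀]
    exact (tensorSequence_shortExact h (normalModule h)).extClass_comp_assoc _

/-- Once ρ restricts to the given action on h, the bracket relation for (x, y) says precisely that g
⊗ n → n commutes with x. -/
theorem alpha_eq_zero_iff : alpha h = 0 ↔ ∃ ρ : g →ₗ[k] Module.End k (normalModule h),
    (∀ (x : h) (y : g), ρ ⁅(x : g), y⁆ = ⁅ρ x, ρ y⁆) ∧
      ∀ (x : h) (v : normalModule h), ρ x v = ⁅x, v⁆ := by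
  rw [alpha_eq_zero_iff_exists_hom]
  constructor
  · rintro ⟨f, hf⟩
    let φ : g ⊗[k] normalModule h → normalModule h := f.hom
    have hadd : ∀ s t, φ (s + t) = φ s + φ t := f.hom.map_add
    have hact : ∀ (u : UniversalEnvelopingAlgebra k h) (t : g ⊗[k] normalModule h),
        φ (UniversalEnvelopingAlgebra.lift k (LieModule.toEnd k h (g ⊗[k] normalModule h)) u t) =
          UniversalEnvelopingAlgebra.lift k (LieModule.toEnd k h (normalModule h)) u (φ t) :=
      fun u t => f.hom.map_smul u t
    have hsmul : ∀ (c : k) t, φ (c • t) = c • φ t := fun c t => by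
      simpa using hact (algebraMap k _ c) t
    have hlie : ∀ (x : h) t, φ ⁅x, t⁆ = ⁅x, φ t⁆ := fun x t => by
      have := hact (UniversalEnvelopingAlgebra.ι k x) t
      rwa [UniversalEnvelopingAlgebra.lift_ι_apply, UniversalEnvelopingAlgebra.lift_ι_apply] at this
    have hφ : ∀ (x : h) (v : normalModule h), φ ((x : g) ⊗ₜ v) = ⁅x, v⁆ := fun x v =>
      congrArg (fun F : (tensorSequence h (normalModule h)).X₁ ⟶ repObj k h (normalModule h) =>
        (F.hom : h ⊗[k] normalModule h → normalModule h) (x ⊗ₜ v)) hf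
    let ψ : g ⊗[k] normalModule h →ₗ[k] normalModule h :=
      { toFun := φ, map_add' := hadd, map_smul' := hsmul }
    have hψ : ∀ a v, TensorProduct.curry ψ a v = φ (a ⊗ₜ v) := fun _ _ => rfl
    refine ⟨TensorProduct.curry ψ, fun x y => ?_, hφ⟩
    ext v
    rw [LieRing.of_associative_ring_bracket, LinearMap.sub_apply, Module.End.mul_apply,
      Module.End.mul_apply, hψ, hψ, hψ, hψ, hψ, hφ, hφ, ← hlie,
      TensorProduct.LieModule.lie_tmul_right, hadd, add_sub_cancel_right]
    rfl
  · rintro ⟨ρ, hρ, hρ'⟩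
    let ψ : g ⊗[k] normalModule h →ₗ⁅k,h⁆ normalModule h :=
      TensorProduct.LieModule.liftLie k h g (normalModule h) (normalModule h)
        { ρ with
          map_lie' := fun {x y} => by
            change ρ ⁅(x : g), y⁆ = ⁅x, ρ y⁆
            ext v
            rw [hρ, LieRing.of_associative_ring_bracket, LinearMap.sub_apply,
              Module.End.mul_apply, Module.End.mul_apply, hρ', hρ', LieHom.lie_apply] }
    refine ⟨repHom k h ψ, ?_⟩
    have : ψ.comp (TensorProduct.LieModule.map h.incl' LieModuleHom.id) =
        LieModule.toModuleHom k h (normalModule h) := by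
      ext t
      induction t using TensorProduct.induction_on with
      | zero => simp
      | tmul x v =>
        rw [LieModuleHom.comp_apply, TensorProduct.LieModule.map_tmul,
          LieModule.toModuleHom_apply]
        exact hρ' x v
      | add a b ha hb => rw [map_add, map_add, ha, hb]
    rw [← this]
    rfl

theorem exists_nbhdModule_iff :
    (∃ (_ : LieRingModule (Nbhd h) (normalModule h)) (_ : LieModule k (Nbhd h) (normalModule h)),
      ∀ (x : h) (v : normalModule h), ⁅nbhdIncl h x, v⁆ = ⁅x, v⁆) ↔
    ∃ ρ : g →ₗ[k] Module.End k (normalModule h),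
      (∀ (x : h) (y : g), ρ ⁅(x : g), y⁆ = ⁅ρ x, ρ y⁆) ∧
        ∀ (x : h) (v : normalModule h), ρ x v = ⁅x, v⁆ := by
  constructor
  · rintro ⟨_, _, hn⟩
    refine ⟨(LieModule.toEnd k (Nbhd h) (normalModule h) : Nbhd h →ₗ[k] _) ∘ₗ nbhdGen h,
      fun x y => ?_, hn⟩
    exact (congrArg (LieModule.toEnd k (Nbhd h) (normalModule h)) (nbhdGen_lie h x y)).trans
      (LieHom.map_lie _ _ _)
  · rintro ⟨ρ, hρ, hρ'⟩
    obtain ⟨F, hF⟩ := exists_lieHom_nbhd h ρ hρ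
    refine ⟨LieRingModule.compLieHom _ F, LieModule.compLieHom _ F, fun x v => ?_⟩
    change F (nbhdGen h x) v = _
    rw [hF, hρ']

/-! ### From a splitting in degree two to an extension of the action -/

theorem tensorToInd_ι_mul_ι (x : h) (a : g) :
    tensorToInd h (TensorAlgebra.ι k (x : g) * TensorAlgebra.ι k a) =
      tensorToInd h (TensorAlgebra.ι k ⁅(x : g), a⁆) := by
  have : tensorToInd h (TensorAlgebra.ι k a * TensorAlgebra.ι k (x : g)) = 0 := by
    rw [tensorToInd_ι_mul, tensorToInd_ι_of_mem, smul_zero]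
  have e : tensorToU h (TensorAlgebra.ι k (x : g) * TensorAlgebra.ι k a) =
      tensorToU h (TensorAlgebra.ι k ⁅(x : g), a⁆ +
        TensorAlgebra.ι k a * TensorAlgebra.ι k (x : g)) := by
    rw [map_add, map_mul, map_mul, tensorToU_ι, tensorToU_ι, tensorToU_ι, nbhdGen_lie,
      LieHom.map_lie, LieRing.of_associative_ring_bracket, sub_add_cancel]
  refine (congrArg (Ind.mk h) e).trans ?_
  change tensorToInd h _ = _
  rw [map_add, this, add_zero]

theorem tensorToInd_ι_mem (a : g) : tensorToInd h (TensorAlgebra.ι k a) ∈ filtration h 1 :=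
  (mem_filtration h).2 ⟨_, tensorPow_le_tensorsLT Nat.one_lt_two (by
    rw [tensorPow, pow_one]
    exact ⟨a, rfl⟩), rfl⟩

theorem smul_mem_filtration (a : g) {m : ℕ} {y : Ind h} (hy : y ∈ filtration h m) :
    UniversalEnvelopingAlgebra.ι k (nbhdGen h a) • y ∈ filtration h (m + 1) := by
  obtain ⟨t, ht, rfl⟩ := hy
  exact (mem_filtration h).2 ⟨_, ι_mul_mem_tensorsLT a ht, tensorToInd_ι_mul h a t⟩

/-- F¹ is spanned by the classes of 1 and of g. The first is killed by h and by F; on the second, x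
· [a] = [[x, a]]. Equivariance is asserted on F¹ only. -/
theorem ind_projection_lie {F : Ind h →ₗ[k] normalModule h} (hF1 : F (Ind.mk h 1) = 0)
    (hFι : ∀ a : g, F (tensorToInd h (TensorAlgebra.ι k a)) = normalProj h a) (x : h) {y : Ind h}
    (hy : y ∈ filtration h 1) : F ⁅x, y⁆ = ⁅x, F y⁆ := by
  obtain ⟨t, ht, rfl⟩ := hy
  have hx : ∀ t, ⁅x, tensorToInd h t⁆ = tensorToInd h (TensorAlgebra.ι k (x : g) * t) :=
    fun t => (tensorToInd_ι_mul h x t).symm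
  have hle : tensorsLT k g 2 ≤ LinearMap.eqLocus
      (F ∘ₗ LieModule.toEnd k h (Ind h) x ∘ₗ tensorToInd h)
      (LieModule.toEnd k h (normalModule h) x ∘ₗ F ∘ₗ tensorToInd h) := by
    rw [tensorsLT_succ, tensorsLT_succ, tensorsLT_zero, bot_sup_eq, sup_le_iff, tensorPow,
      tensorPow, pow_zero, pow_one]
    constructor
    · rintro _ ⟨c, rfl⟩
      rw [LinearMap.toSpanSingleton_apply]
      change F ⁅x, tensorToInd h (c • 1)⁆ = ⁅x, F (tensorToInd h (c • 1))⁆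
      rw [map_smul, tensorToInd_one, map_smul, hF1, smul_zero,
        lie_zero, lie_smul, ← tensorToInd_one, hx, mul_one, tensorToInd_ι_of_mem, smul_zero,
        map_zero]
    · rintro _ ⟨a, rfl⟩
      change F ⁅x, tensorToInd h (TensorAlgebra.ι k a)⁆ =
        ⁅x, F (tensorToInd h (TensorAlgebra.ι k a))⁆
      rw [hx, tensorToInd_ι_mul_ι, hFι, hFι, normalProj_lie]
  exact hle ht

/-- The embedding of `n` in `U(h⁽¹⁾) / U(h⁽¹⁾) h`. -/
def normalToInd : normalModule h →ₗ[k] Ind h :=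
  Submodule.liftQ h.toLieSubmodule.toSubmodule (tensorToInd h ∘ₗ TensorAlgebra.ι k)
    fun x hx => tensorToInd_ι_of_mem h ⟨x, hx⟩

theorem normalToInd_normalProj (a : g) :
    normalToInd h (normalProj h a) = tensorToInd h (TensorAlgebra.ι k a) := rfl

theorem normalToInd_mem (v : normalModule h) : normalToInd h v ∈ filtration h 1 := by
  obtain ⟨a, rfl⟩ := LieSubmodule.Quotient.surjective_mk' _ v
  exact tensorToInd_ι_mem h a

theorem smul_normalToInd (x : h) (v : normalModule h) :
    UniversalEnvelopingAlgebra.ι k (nbhdGen h x) • normalToInd h v = normalToInd h ⁅x, v⁆ := by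
  obtain ⟨a, rfl⟩ := LieSubmodule.Quotient.surjective_mk' _ v
  rw [← normalProj_lie, normalToInd_normalProj, normalToInd_normalProj, ← tensorToInd_ι_mul,
    tensorToInd_ι_mul_ι]

/-- The multiplication `g ⊗ n → F²`. -/
def mulNormal : g →ₗ[k] normalModule h →ₗ[k] filtration h 2 :=
  LinearMap.mk₂ k
    (fun a v => ⟨UniversalEnvelopingAlgebra.ι k (nbhdGen h a) • normalToInd h v,
      smul_mem_filtration h a (normalToInd_mem h v)⟩)
    (fun a b v => Subtype.ext (by
      change _ • normalToInd h v = _ • normalToInd h v + _ • normalToInd h v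
      rw [map_add, map_add, add_smul]))
    (fun c a v => Subtype.ext (by
      change _ • normalToInd h v = c • _ • normalToInd h v
      rw [map_smul, map_smul, smul_assoc]))
    (fun a v w => Subtype.ext (by
      change _ • normalToInd h (v + w) = _ • normalToInd h v + _ • normalToInd h w
      rw [map_add, smul_add]))
    (fun c a v => Subtype.ext (by
      change _ • normalToInd h (c • v) = c • _ • normalToInd h v
      rw [map_smul, ← algebraMap_smul (UniversalEnvelopingAlgebra k (Nbhd h)) c,
        ← algebraMap_smul (UniversalEnvelopingAlgebra k (Nbhd h)) c, ← mul_smul, ← mul_smul,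
        Algebra.commutes]))

theorem coe_mulNormal (a : g) (v : normalModule h) : (mulNormal h a v : Ind h) =
    UniversalEnvelopingAlgebra.ι k (nbhdGen h a) • normalToInd h v := rfl

theorem mulNormal_lie (x : h) (y : g) (v : normalModule h) :
    mulNormal h ⁅(x : g), y⁆ v = ⁅x, mulNormal h y v⁆ - mulNormal h y ⁅x, v⁆ := by
  ext
  change UniversalEnvelopingAlgebra.ι k (nbhdGen h ⁅(x : g), y⁆) • normalToInd h v =
    UniversalEnvelopingAlgebra.ι k (nbhdGen h x) •
      UniversalEnvelopingAlgebra.ι k (nbhdGen h y) • normalToInd h v -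
    UniversalEnvelopingAlgebra.ι k (nbhdGen h y) • normalToInd h ⁅x, v⁆
  rw [nbhdGen_lie, LieHom.map_lie, LieRing.of_associative_ring_bracket, sub_smul, mul_smul,
    mul_smul, smul_normalToInd]

/-- If the filtration splits in degree two, then the action of `h` on `n` extends to `g`. -/
theorem exists_extension_of_isSplitting {σ : filtrationQuotient h 1 →ₗ⁅k,h⁆ filtration h 2}
    (hσ : IsSplitting h 1 σ) : ∃ ρ : g →ₗ[k] Module.End k (normalModule h),
    (∀ (x : h) (y : g), ρ ⁅(x : g), y⁆ = ⁅ρ x, ρ y⁆) ∧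
      ∀ (x : h) (v : normalModule h), ρ x v = ⁅x, v⁆ := by
  obtain ⟨F, hF1, hFι⟩ := exists_ind_projection h
  let π : filtration h 2 →ₗ⁅k,h⁆ filtrationQuotient h 1 := LieSubmodule.Quotient.mk' _
  -- The h-linear retraction of F² onto F¹ complementary to σ.
  let r : filtration h 2 →ₗ⁅k,h⁆ filtration h 2 := LieModuleHom.id - σ.comp π
  have hr : ∀ y, r y = y - σ (π y) := fun _ => rfl
  have hmem : ∀ y, (r y : Ind h) ∈ filtration h 1 := by
    intro y
    have : π (r y) = 0 := by rw [hr, map_sub, hσ, sub_self]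
    exact (LieSubmodule.Quotient.mk_eq_zero
      ((filtration h 1).comap (filtration h 2).incl)).1 this
  let q : filtration h 2 →ₗ[k] normalModule h :=
    F ∘ₗ (filtration h 2).toSubmodule.subtype ∘ₗ (r : filtration h 2 →ₗ[k] filtration h 2)
  have hq : ∀ y, q y = F (r y) := fun _ => rfl
  have hqlie : ∀ (x : h) y, q ⁅x, y⁆ = ⁅x, q y⁆ := by
    intro x y
    rw [hq, hq, ← ind_projection_lie h hF1 hFι x (hmem y), LieModuleHom.map_lie]
    rfl
  have hρ : ∀ (x : h) (v : normalModule h), q (mulNormal h x v) = ⁅x, v⁆ := by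
    intro x v
    -- For x ∈ h the product x · v already lies in F¹, where r is the identity.
    have h0 : π (mulNormal h x v) = 0 := (LieSubmodule.Quotient.mk_eq_zero
        ((filtration h 1).comap (filtration h 2).incl)).2 (by
      change (mulNormal h x v : Ind h) ∈ filtration h 1
      rw [coe_mulNormal, smul_normalToInd]
      exact normalToInd_mem h _)
    rw [hq, hr, h0, map_zero, sub_zero, coe_mulNormal, smul_normalToInd]
    obtain ⟨a, ha⟩ := LieSubmodule.Quotient.surjective_mk' _ ⁅x, v⁆
    rw [← ha, normalToInd_normalProj, hFι]
  refine ⟨(mulNormal h).compr₂ q, fun x y => ?_, hρ⟩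
  ext v
  change q (mulNormal h ⁅(x : g), y⁆ v) =
    q (mulNormal h x (q (mulNormal h y v))) - q (mulNormal h y (q (mulNormal h x v)))
  rw [mulNormal_lie, map_sub, hqlie, hρ, hρ]

end LiePBW

end

/-! ### The main theorem -/

theorem mainTheorem2 {k : Type*} {g : Type*} [Field k] [LieRing g] [LieAlgebra k g]
    (h : LieSubalgebra k g) :
    -- the filtration splits if and only if the class is trivial
    (LiePBW.FiltrationSplits h ↔ LiePBW.alpha h = 0) ∧
    -- triviality of the class means that `n` extends to an `h⁽¹⁾`-module
    (LiePBW.alpha h = 0 ↔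
      ∃ (_ : LieRingModule (LiePBW.Nbhd h) (LiePBW.normalModule h))
        (_ : LieModule k (LiePBW.Nbhd h) (LiePBW.normalModule h)),
        ∀ (x : h) (v : LiePBW.normalModule h), ⁅LiePBW.nbhdIncl h x, v⁆ = ⁅x, v⁆) ∧
    -- every such extension yields splitting maps by iteration
    (∀ [LieRingModule (LiePBW.Nbhd h) (LiePBW.normalModule h)]
        [LieModule k (LiePBW.Nbhd h) (LiePBW.normalModule h)],
      (∀ (x : h) (v : LiePBW.normalModule h), ⁅LiePBW.nbhdIncl h x, v⁆ = ⁅x, v⁆) →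
      ∃ s : ∀ m : ℕ, MultilinearMap k (fun _ : Fin m => LiePBW.normalModule h) (LiePBW.Ind h),
        s 0 ![] = LiePBW.Ind.mk h 1 ∧
        (∀ (m : ℕ) (a : g) (X : Fin m → LiePBW.normalModule h),
          s (m + 1) (Fin.cons (LiePBW.normalProj h a) X) =
            UniversalEnvelopingAlgebra.ι k (LiePBW.nbhdGen h a) • s m X -
              ∑ i, s m (Function.update X i ⁅LiePBW.nbhdGen h a, X i⁆)) ∧
        ∀ m : ℕ, ∃ σ : LiePBW.filtrationQuotient h m →ₗ⁅k,h⁆ LiePBW.filtration h (m + 1),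
          LiePBW.IsSplitting h m σ ∧
          ∀ (a : Fin (m + 1) → g) (y : LiePBW.filtration h (m + 1)),
            (y : LiePBW.Ind h) = LiePBW.tensorToInd h (TensorAlgebra.tprod k g (m + 1) a) →
            (σ (LieSubmodule.Quotient.mk' _ y) : LiePBW.Ind h) =
              s (m + 1) (fun i => LiePBW.normalProj h (a i))) := by
  have h1 : LiePBW.FiltrationSplits h ↔ LiePBW.alpha h = 0 := by
    rw [LiePBW.alpha_eq_zero_iff]
    constructor
    · intro hs
      -- Index 1 is the step F¹ ⊆ F², the only one needed.
      obtain ⟨σ, hσ⟩ := hs 1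
      exact LiePBW.exists_extension_of_isSplitting h hσ
    · rintro ⟨ρ, hρ, hρ'⟩ m
      obtain ⟨S, hS⟩ := LiePBW.exists_tensorSection hρ hρ'
      obtain ⟨σ, hσ, -⟩ := LiePBW.exists_splitting hρ hρ' hS m
      exact ⟨σ, hσ⟩
  refine ⟨h1, (LiePBW.alpha_eq_zero_iff h).trans (LiePBW.exists_nbhdModule_iff h).symm, ?_⟩
  intro _ _ hn
  let ρ : g →ₗ[k] Module.End k (LiePBW.normalModule h) :=
    (LieModule.toEnd k (LiePBW.Nbhd h) (LiePBW.normalModule h) : LiePBW.Nbhd h →ₗ[k] _) ∘ₗ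
      LiePBW.nbhdGen h
  have hρ : ∀ (x : h) (y : g), ρ ⁅(x : g), y⁆ = ⁅ρ x, ρ y⁆ := fun x y =>
    (congrArg (LieModule.toEnd k (LiePBW.Nbhd h) (LiePBW.normalModule h))
      (LiePBW.nbhdGen_lie h x y)).trans (LieHom.map_lie _ _ _)
  obtain ⟨S, hS⟩ := LiePBW.exists_tensorSection hρ hn
  -- sₘ is the restriction of S to tensors of degree m.
  refine ⟨fun m => S.compMultilinearMap (TensorAlgebra.tprod k _ m), ?_, fun m a X => ?_,
    fun m => LiePBW.exists_splitting hρ hn hS m⟩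
  · rw [LinearMap.compMultilinearMap_apply, TensorAlgebra.tprod_apply, List.ofFn_zero,
      List.prod_nil, ← LiePBW.tensorOrbit_one ρ, hS, LiePBW.tensorToInd_one]
  · have e : TensorAlgebra.tprod k (LiePBW.normalModule h) (m + 1)
        (Fin.cons (LiePBW.normalProj h a) X) = TensorAlgebra.ι k (LiePBW.normalProj h a) *
          TensorAlgebra.tprod k (LiePBW.normalModule h) m X := by
      simp only [TensorAlgebra.tprod_apply, List.ofFn_succ, List.prod_cons, Fin.cons_zero,
        Fin.cons_succ]
    simp only [LinearMap.compMultilinearMap_apply]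
    rw [e, ← LiePBW.tensorSection_tensorAction hS, LiePBW.tensorAction_apply, map_add,
      LiePBW.tensorDerivation_tprod, map_sum]
    exact (add_sub_cancel_right _ _).symm
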